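/- Let $\mu\ge 0$, let $B^2=\{(x,y)\in\mathbb R^2: x^2+y^2\le 1\}$, $W_\mu(x,y)=(1-x^2-y^2)^{\mu-1/2}$ and $a_\mu=(\mu+\tfrac12)/\pi$, and equip $L^2(W_\mu;B^2)$ (real-valued functions) with $\langle f,g\rangle_\mu=a_\mu\int_{B^2} f g\,W_\mu\,dx\,dy$. Let $\mathcal V_k^2(W_\mu)$ be the space of polynomials in two variables of total degree at most $k$ that are orthogonal to all polynomials of total degree less than $k$, and let $\operatorname{proj}_k^\mu$ be the orthogonal projection of $L^2(W_\mu;B^2)$ onto $\mathcal V_k^2(W_\mu)$. For $\theta\in\mathbb R$ and $t\in[-1,1]$ put $$\mathcal R_\theta^\mu(f;t)=\int_{-\sqrt{1-t^2}}^{\sqrt{1-t^2}} (fW_\mu)(t\cos\theta-s\sin\theta,\;t\sin\theta+s\cos\theta)\,ds .$$ Let $C_k^{\lambda}$ be the Gegenbauer polynomials: $C_0^\lambda=1$, $C_1^\lambda(t)=2\lambda t$, $(k+2)C_{k+2}^\lambda(t)=2(k+1+\lambda)\,t\,C_{k+1}^\lambda(t)-(k+2\lambda)C_k^\lambda(t)$.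 Let $p_l^{(\alpha,\beta)}$ be the Jacobi polynomial of degree $l$, with positive leading coefficient, orthonormal with respect to $(1-t)^\alpha(1+t)^\beta$ on $[-1,1]$ normalized to total mass one. For $0\le 2l\le k$ let $$h_{l,k}=\Bigl(\frac{\Gamma(k-2l+\mu+\frac32)}{\Gamma(\mu+\frac32)\Gamma(k-2l+1)}\Bigr)^{1/2},\qquad H_{l,k}^\mu=h_{l,k}\,p_l^{(\mu-\frac12,\,k-2l)}(1),\qquad \lambda_{l,k}^\mu=[H_{l,k}^\mu]^{-2},$$ and, for $x=r\cos\phi$, $y=r\sin\phi$, with $\sigma_{l,k}=\sqrt2$ if $2l<k$ and $\sigma_{l,k}=1$ if $2l=k$, $$P_{l,0}^k(x,y)=\sigma_{l,k}h_{l,k}\,p_l^{(\mu-\frac12,k-2l)}(2r^2-1)\,r^{k-2l}\cos (k-2l)\phi,\qquad P_{l,1}^k(x,y)=\sigma_{l,k}h_{l,k}\,p_l^{(\mu-\frac12,k-2l)}(2r^2-1)\,r^{k-2l}\sin (k-2l)\phi$$ (so $P_{l,1}^k=0$ if $2l=k$; the remaining $P_{l,\varepsilon}^k$ are the standard polar-coordinate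 orthonormal basis of $\mathcal V_k^2(W_\mu)$). Define $$D_k^{\mu+1/2}(\xi;x,y)=\sum_{0\le 2l\le k}\lambda_{l,k}^\mu\sum_{\varepsilon\in\{0,1\}}P_{l,\varepsilon}^k(\cos\xi,\sin\xi)\,P_{l,\varepsilon}^k(x,y),$$ $$D_k^{\mu+1/2}(\xi,t;x,y)=\frac{k+\mu+\frac12}{\mu+\frac12}\,C_k^{\mu+1/2}(t)\,D_k^{\mu+1/2}(\xi;x,y).$$ **Theorem.** Let $0\le k\le n$ be integers, $\xi_\nu=\nu\pi/(n+1)$, and $f\in L^2(W_\mu;B^2)$. For every $\theta$ the integral defining $\mathcal R^\mu_\theta(f;t)$ converges absolutely for almost every $t\in[-1,1]$, and $t\mapsto\mathcal R^\mu_\theta(f;t)\,D_k^{\mu+1/2}(\theta,t;x,y)$ is integrable on $[-1,1]$ for all $x,y\in\mathbb R$. The projection $\operatorname{proj}_k^\mu f$, as a polynomial of total degree at most $k$, satisfies for all $(x,y)\in\mathbb R^2$ $$\operatorname{proj}_k^\mu f(x,y)=\frac1{n+1}\sum_{\nu=0}^{n}a_\mu\int_{-1}^1\mathcal R^\mu_{\xi_\nu}(f;t)\,D_k^{\mu+1/2}(\xi_\nu,t;x,y)\,dt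 =\frac1{2n+2}\sum_{\nu=0}^{2n+1}a_\mu\int_{-1}^1\mathcal R^\mu_{\xi_\nu}(f;t)\,D_k^{\mu+1/2}(\xi_\nu,t;x,y)\,dt .$$ -/

import Mathlib

open MeasureTheory

namespace AttRadon

noncomputable section

/-- The closed unit disk `B²` of the plane. -/
def disk : Set (ℝ × ℝ) := {p | p.1 ^ 2 + p.2 ^ 2 ≤ 1}

/-- The weight `W_μ(x,y) = (1 - x² - y²)^(μ - 1/2)` (used only at points of the disk). -/
def weight (μ : ℝ) (p : ℝ × ℝ) : ℝ := (1 - p.1 ^ 2 - p.2 ^ 2) ^ (μ - 1 / 2)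

/-- The constant `a_μ = (μ + 1/2) / π`, which makes `a_μ W_μ dx dy` a probability measure on the
disk. -/
def aConst (μ : ℝ) : ℝ := (μ + 1 / 2) / Real.pi

/-- The measure `a_μ W_μ(x,y) dx dy` on the disk. The inner product of its `L²` space is
`⟨f, g⟩_μ = a_μ ∫_{B²} f g W_μ dx dy`. -/
def diskMeasure (μ : ℝ) : Measure (ℝ × ℝ) :=
  (volume.restrict disk).withDensity fun p => ENNReal.ofReal (aConst μ * weight μ p)

/-- The Hilbert space `L²(W_μ; B²)`. -/
abbrev DiskL2 (μ : ℝ) := Lp ℝ 2 (diskMeasure μ)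

/-- The function on the plane defined by a polynomial in two variables. -/
def polyFun (P : MvPolynomial (Fin 2) ℝ) (p : ℝ × ℝ) : ℝ := MvPolynomial.eval ![p.1, p.2] P

/-- The space `Π_m²` of polynomials of total degree at most `m`, as a subspace of
`L²(W_μ; B²)`. (For `μ ≥ 0` the measure is finite, so every polynomial has a class in `L²`.) -/
def polySpace (μ : ℝ) (m : ℕ) : Submodule ℝ (DiskL2 μ) where
  carrier := {g | ∃ P : MvPolynomial (Fin 2) ℝ,
    P ∈ MvPolynomial.restrictTotalDegree (Fin 2) ℝ m ∧ g =ᵐ[diskMeasure μ] polyFun P}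
  zero_mem' := by
    refine ⟨0, Submodule.zero_mem _, ?_⟩
    filter_upwards [Lp.coeFn_zero ℝ 2 (diskMeasure μ)] with p hp
    exact hp.trans (by simp [polyFun])
  add_mem' := by
    rintro g h ⟨P, hP, hg⟩ ⟨Q, hQ, hh⟩
    refine ⟨P + Q, Submodule.add_mem _ hP hQ, ?_⟩
    filter_upwards [Lp.coeFn_add g h, hg, hh] with p h1 h2 h3
    exact h1.trans (by simp [Pi.add_apply, h2, h3, polyFun])
  smul_mem' := by
    rintro c g ⟨P, hP, hg⟩
    refine ⟨c • P, Submodule.smul_mem _ c hP, ?_⟩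
    filter_upwards [Lp.coeFn_smul c g, hg] with p h1 h2
    exact h1.trans (by simp [Pi.smul_apply, h2, polyFun])

instance polySpace_finite (μ : ℝ) (m : ℕ) : FiniteDimensional ℝ (polySpace μ m) := by
  classical
  let S : Submodule ℝ (MvPolynomial.restrictTotalDegree (Fin 2) ℝ m) :=
    { carrier := {P | MemLp (polyFun P.1) 2 (diskMeasure μ)}
      zero_mem' := by
        have h : polyFun (0 : MvPolynomial (Fin 2) ℝ) = 0 := by funext p; simp [polyFun]
        simp [h]
      add_mem' := by
        intro P Q hP hQ
        have h : polyFun (P.1 + Q.1) = polyFun P.1 + polyFun Q.1 := by funext p; simp [polyFun]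
        simpa [h] using MemLp.add hP hQ
      smul_mem' := by
        intro c P hP
        have h : polyFun (c • P.1) = c • polyFun P.1 := by funext p; simp [polyFun]
        simpa [h] using MemLp.const_smul hP c }
  let T : S →ₗ[ℝ] DiskL2 μ :=
    { toFun := fun P => MemLp.toLp (polyFun P.1.1) P.2
      map_add' := by
        intro P Q
        rw [← MemLp.toLp_add]
        congr 1
        funext p; simp [polyFun]
      map_smul' := by
        intro c P
        rw [RingHom.id_apply, ← MemLp.toLp_const_smul]
        congr 1
        funext p; simp [polyFun] }
  have hle : polySpace μ m ≤ LinearMap.range T := by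
    rintro g ⟨P, hP, hg⟩
    have hmem : MemLp (polyFun P) 2 (diskMeasure μ) := (memLp_congr_ae hg).1 (Lp.memLp g)
    refine ⟨⟨⟨P, hP⟩, hmem⟩, ?_⟩
    apply Lp.ext
    exact (MemLp.coeFn_toLp hmem).trans hg.symm
  exact Submodule.finiteDimensional_of_le hle

/-- The space `𝒱_k²(W_μ)` of orthogonal polynomials of degree `k`: polynomials of total degree at
most `k` which are orthogonal in `L²(W_μ; B²)` to all polynomials of degree less than `k`. -/
def orthPolySpace (μ : ℝ) (k : ℕ) : Submodule ℝ (DiskL2 μ) :=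
  polySpace μ k ⊓ ⨅ j : Fin k, (polySpace μ j)ᗮ

instance orthPolySpace_finite (μ : ℝ) (k : ℕ) : FiniteDimensional ℝ (orthPolySpace μ k) :=
  Submodule.finiteDimensional_of_le (S₂ := polySpace μ k) inf_le_left

/-- The orthogonal projection `proj_k^μ` of `L²(W_μ; B²)` onto `𝒱_k²(W_μ)`. -/
def diskProj (μ : ℝ) (k : ℕ) : DiskL2 μ →L[ℝ] DiskL2 μ := (orthPolySpace μ k).starProjection

/-- `f W_μ` along the line `x cos θ + y sin θ = t`, parametrized by arc length `s`. -/
def lineIntegrand (μ : ℝ) (f : ℝ × ℝ → ℝ) (θ t s : ℝ) : ℝ :=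
  f (t * Real.cos θ - s * Real.sin θ, t * Real.sin θ + s * Real.cos θ) *
    weight μ (t * Real.cos θ - s * Real.sin θ, t * Real.sin θ + s * Real.cos θ)

/-- The attenuated Radon projection `R_θ^μ(f;t)`: the integral of `f W_μ` over the segment
`{x cos θ + y sin θ = t} ∩ B²`. -/
def radon (μ : ℝ) (f : ℝ × ℝ → ℝ) (θ t : ℝ) : ℝ :=
  ∫ s in (-√(1 - t ^ 2))..√(1 - t ^ 2), lineIntegrand μ f θ t s

/-- The Gegenbauer polynomials `C_k^lam`, by their three-term recurrence. -/
def gegenbauer (lam : ℝ) : ℕ → Polynomial ℝ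
  | 0 => 1
  | 1 => Polynomial.C (2 * lam) * Polynomial.X
  | k + 2 => Polynomial.C (2 * (k + 1 + lam) / (k + 2)) * Polynomial.X * gegenbauer lam (k + 1)
      - Polynomial.C ((k + 2 * lam) / (k + 2)) * gegenbauer lam k

/-- The rising factorial `(a)_n = a (a + 1) ⋯ (a + n - 1)`. -/
def risingFac (a : ℝ) (n : ℕ) : ℝ := ∏ i ∈ Finset.range n, (a + i)

/-- The Jacobi polynomial `P_n^{(α,β)}(t)` in its classical normalization,
`(α+1)_n / n! · ₂F₁(-n, n+α+β+1; α+1; (1-t)/2)`. -/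
def jacobi (α β : ℝ) (n : ℕ) (t : ℝ) : ℝ :=
  risingFac (α + 1) n / (n.factorial : ℝ) *
    ∑ j ∈ Finset.range (n + 1),
      risingFac (-(n : ℝ)) j * risingFac (n + α + β + 1) j /
        (risingFac (α + 1) j * (j.factorial : ℝ)) * ((1 - t) / 2) ^ j

/-- The Jacobi weight `(1-t)^α (1+t)^β`. -/
def jacobiWeight (α β t : ℝ) : ℝ := (1 - t) ^ α * (1 + t) ^ β

/-- The squared norm of `P_n^{(α,β)}` for the Jacobi weight normalized to total mass one. -/
def jacobiNormSq (α β : ℝ) (n : ℕ) : ℝ :=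
  (∫ t in (-1 : ℝ)..1, jacobiWeight α β t)⁻¹ *
    ∫ t in (-1 : ℝ)..1, jacobi α β n t ^ 2 * jacobiWeight α β t

/-- The orthonormal Jacobi polynomial `p_n^{(α,β)}`, for the Jacobi weight normalized to total
mass one. -/
def orthoJacobi (α β : ℝ) (n : ℕ) (t : ℝ) : ℝ := jacobi α β n t / √(jacobiNormSq α β n)

/-- The constant `h_{l,k}`, for `2l ≤ k`:
`h_{l,k}² = Γ(k-2l+μ+3/2) / (Γ(μ+3/2) Γ(k-2l+1))`. -/
def hConst (μ : ℝ) (l k : ℕ) : ℝ :=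
  √(Real.Gamma ((k - 2 * l : ℕ) + μ + 3 / 2) /
    (Real.Gamma (μ + 3 / 2) * Real.Gamma ((k - 2 * l : ℕ) + 1)))

/-- The constant `H_{l,k} = h_{l,k} p_l^{(μ-1/2, k-2l)}(1)`. -/
def bigHConst (μ : ℝ) (l k : ℕ) : ℝ :=
  hConst μ l k * orthoJacobi (μ - 1 / 2) (k - 2 * l : ℕ) l 1

/-- The radial part of the polar basis, with `m = k - 2l`:
`σ h_{l,k} p_l^{(μ-1/2, m)}(2r²-1) r^m`, where `σ = √2` if `m > 0` and `σ = 1` if `m = 0`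
(the mean square of `cos mφ` and of `sin mφ` is `1/2` for `m > 0`). -/
def radialPart (μ : ℝ) (l k : ℕ) (r : ℝ) : ℝ :=
  (if 2 * l < k then √2 else 1) * hConst μ l k *
    orthoJacobi (μ - 1 / 2) (k - 2 * l : ℕ) l (2 * r ^ 2 - 1) * r ^ (k - 2 * l)

/-- The polynomial `P_{l,0}^k`: the radial part times `cos (k-2l)φ`, at `x = r cos φ`,
`y = r sin φ`. -/
def basisCos (μ : ℝ) (l k : ℕ) (x y : ℝ) : ℝ :=
  radialPart μ l k ‖(⟨x, y⟩ : ℂ)‖ * Real.cos ((k - 2 * l : ℕ) * Complex.arg ⟨x, y⟩)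

/-- The polynomial `P_{l,1}^k`: the radial part times `sin (k-2l)φ`, at `x = r cos φ`,
`y = r sin φ`. It vanishes identically if `2l = k`. -/
def basisSin (μ : ℝ) (l k : ℕ) (x y : ℝ) : ℝ :=
  radialPart μ l k ‖(⟨x, y⟩ : ℂ)‖ * Real.sin ((k - 2 * l : ℕ) * Complex.arg ⟨x, y⟩)

/-- `D_k^{μ+1/2}(ξ; x, y)`, the sum over `0 ≤ 2l ≤ k` and over the cosine and sine elements of
`H_{l,k}^{-2} P(cos ξ, sin ξ) P(x, y)`. -/
def dSum (μ : ℝ) (k : ℕ) (ξ x y : ℝ) : ℝ :=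
  ∑ l ∈ Finset.range (k / 2 + 1), (bigHConst μ l k ^ 2)⁻¹ *
    (basisCos μ l k (Real.cos ξ) (Real.sin ξ) * basisCos μ l k x y +
      basisSin μ l k (Real.cos ξ) (Real.sin ξ) * basisSin μ l k x y)

/-- `D_k^{μ+1/2}(ξ, t; x, y) = (k+μ+1/2)/(μ+1/2) · C_k^{μ+1/2}(t) · D_k^{μ+1/2}(ξ; x, y)`. -/
def dKernel (μ : ℝ) (k : ℕ) (ξ t x y : ℝ) : ℝ :=
  (k + μ + 1 / 2) / (μ + 1 / 2) * (gegenbauer (μ + 1 / 2) k).eval t * dSum μ k ξ x y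

/-- The angle `ξ_ν = ν π / (n + 1)`. -/
def xi (n ν : ℕ) : ℝ := ν * Real.pi / (n + 1)

end

end AttRadon

/-!
The proof is algebra over the moments of the disk. Write `lam = μ + 1/2`, `z = x + iy`, `w = z̄`.
In polar coordinates `∫ z^a z̄^b dm = δ_{ab} a! / (lam+1)_a` (`integral_monomial_diskMeasure`), and
all orthogonality relations are derived from these values for a functional `E` on polynomials in
`z` and `w` (`IsDiskMoment`).

The disk polynomials `Z_{a,b}` (`zernike`), normalized by `Z_{a,b}(e^{iφ}) = e^{i(a-b)φ}`, are
orthogonal to all polynomials of degree below `a + b`; this is an alternating binomial sum. Since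
`E` is nondegenerate in each degree, every element of `𝒱_k` is `∑ d_a Z_{a,k-a}`
(`IsDiskMoment.exists_eq_sum_zernike`). By the three-term recurrence the ridge polynomial
`C_k^lam(x cos ξ + y sin ξ)` also lies in `𝒱_k` (`IsDiskMoment.ridge_mul_of_mem_degLT`), and pairing
with it is `lam / (k + lam)` times evaluation at `e^{iξ}` (`IsDiskMoment.ridge_mul_zernike`).

By Fubini in rotated coordinates, `a_μ ∫ R_ξ(f;t) g(t) dt = ∫ f(p) g(⟨p, ξ⟩) dm`
(`integral_radon_mul`). For `g = C_k^lam`, up to the factor above, this is the value of `proj_k f`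
at `e^{iξ}`, that is `∑ d_a e^{i(2a-k)ξ}` (`exists_zernike_expansion`). On the other side the
normalizing constants cancel in `D_k`, leaving `D_k(ξ; x, y) = ∑ e^{-i(2a-k)ξ} Z_{a,k-a}(x, y)`
(`dSum_eq`). The average over the nodes `ξ_ν` then reduces to the orthogonality of the roots of
unity `e^{2i(a-b)ξ_ν}`, where `|a - b| ≤ k ≤ n` (`sum_exp_xi`).
-/

namespace AttRadon

open MvPolynomial

/-! ### Rising factorials and two binomial sums -/

theorem risingFac_zero (a : ℝ) : risingFac a 0 = 1 := by simp [risingFac]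

theorem risingFac_succ (a : ℝ) (n : ℕ) : risingFac a (n + 1) = risingFac a n * (a + n) := by
  simp [risingFac, Finset.prod_range_succ]

theorem risingFac_succ' (a : ℝ) (n : ℕ) : risingFac a (n + 1) = a * risingFac (a + 1) n := by
  simp only [risingFac, Finset.prod_range_succ', Nat.cast_zero, add_zero, Nat.cast_succ]
  rw [mul_comm]
  congr 1
  exact Finset.prod_congr rfl fun i _ => by ring

theorem risingFac_add (a : ℝ) (m n : ℕ) :
    risingFac a (m + n) = risingFac a m * risingFac (a + m) n := by
  induction n with
  | zero => simp [risingFac_zero]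
  | succ n ih => rw [← add_assoc, risingFac_succ, ih, risingFac_succ]; push_cast; ring

theorem risingFac_pos {a : ℝ} (ha : 0 < a) (n : ℕ) : 0 < risingFac a n :=
  Finset.prod_pos fun i _ => by positivity

theorem cast_descFactorial_succ (a j : ℕ) :
    (a.descFactorial (j + 1) : ℝ) = (a - j) * a.descFactorial j := by
  rw [Nat.descFactorial_succ]
  rcases le_or_gt j a with h | h
  · push_cast [Nat.cast_sub h]; ring
  · simp [Nat.descFactorial_of_lt h]

/-- The Chu–Vandermonde sum in factorial form. -/
theorem sum_choose_descFactorial_risingFac (i a : ℕ) (x : ℝ) :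
    ∑ j ∈ Finset.range (i + 1), (i.choose j : ℝ) * (a.descFactorial j * risingFac (x + j) (i - j))
      = risingFac (x + a) i := by
  induction i generalizing x with
  | zero => simp [risingFac_zero]
  | succ i ih =>
    rw [Finset.sum_choose_succ_mul (fun j r => (a.descFactorial j : ℝ) * risingFac (x + j) r) i,
      ← Finset.sum_add_distrib, risingFac_succ', show x + a + 1 = (x + 1) + a by ring, ← ih (x + 1),
      Finset.mul_sum]
    refine Finset.sum_congr rfl fun j hj => ?_
    have hj' : j ≤ i := Nat.lt_succ_iff.1 (Finset.mem_range.1 hj)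
    rw [Nat.succ_sub hj', risingFac_succ', cast_descFactorial_succ]
    push_cast
    rw [show x + (j + 1 : ℝ) = x + 1 + j by ring, show x + j + 1 = x + 1 + (j : ℝ) by ring]
    ring

/-- The Chu–Vandermonde sum in quotient form. -/
theorem sum_choose_descFactorial_div {x : ℝ} (hx : 0 < x) (i a : ℕ) :
    ∑ j ∈ Finset.range (i + 1), (i.choose j : ℝ) * (a.descFactorial j / risingFac x j)
      = risingFac (x + a) i / risingFac x i := by
  rw [← sum_choose_descFactorial_risingFac, Finset.sum_div]
  refine Finset.sum_congr rfl fun j hj => ?_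
  have hj' : j ≤ i := Nat.lt_succ_iff.1 (Finset.mem_range.1 hj)
  have h := risingFac_add x j (i - j)
  rw [Nat.add_sub_cancel' hj'] at h
  have h1 := (risingFac_pos hx j).ne'
  have h2 := (risingFac_pos (by positivity : 0 < x + j) (i - j)).ne'
  rw [h]
  field_simp

theorem sum_alternating_choose (a c d : ℕ) :
    ∑ j ∈ Finset.range (a + 1), (a.choose j : ℝ) * ((-1) ^ j * ((a + c - j).choose d : ℝ))
      = if a ≤ d then (c.choose (d - a) : ℝ) else 0 := by
  induction a generalizing c with
  | zero => simp
  | succ a ih =>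
    rw [Finset.sum_choose_succ_mul (fun j _ => (-1 : ℝ) ^ j * ((a + 1 + c - j).choose d : ℝ)) a]
    have h1 := ih (c + 1)
    have h2 := ih c
    have e1 : ∀ j, a + 1 + c - j = a + (c + 1) - j := fun j => by omega
    have e2 : ∀ j, a + 1 + c - (j + 1) = a + c - j := fun j => by omega
    simp only [e2, pow_succ, mul_one, neg_mul, mul_neg, Finset.sum_neg_distrib, h2]
    simp only [e1, h1]
    rcases lt_trichotomy a d with h | h | h
    · obtain ⟨e, rfl⟩ := Nat.exists_eq_add_of_lt h
      rw [if_pos (by omega), if_pos (by omega), if_pos (by omega),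
        show a + e + 1 - a = e + 1 by omega, show a + e + 1 - (a + 1) = e by omega,
        Nat.choose_succ_succ]
      push_cast; ring
    · subst h; simp
    · rw [if_neg (by omega), if_neg (by omega), if_neg (by omega)]; simp

/-! ### Polynomials in `z` and `z̄` and the moment functional of the disk -/

/-- The monomial `z^a w^b`; the variable `w` stands for the conjugate of `z`. -/
noncomputable def mono (a b : ℕ) : MvPolynomial (Fin 2) ℂ := X 0 ^ a * X 1 ^ b

theorem mono_mul (a b c d : ℕ) : mono a b * mono c d = mono (a + c) (b + d) := by
  simp only [mono, pow_add]; ring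

theorem mono_zero : mono 0 0 = 1 := by simp [mono]

theorem mono_pow (a b j : ℕ) : mono a b ^ j = mono (a * j) (b * j) := by
  simp only [mono, mul_pow, pow_mul]

/-- The polynomials of total degree less than `k`. The strict bound makes the space for `k = 0`
trivial, which is where inductions on the degree start. -/
noncomputable def degLT (k : ℕ) : Submodule ℂ (MvPolynomial (Fin 2) ℂ) :=
  Submodule.span ℂ {p | ∃ a b : ℕ, a + b < k ∧ p = mono a b}

theorem mono_mem_degLT {a b k : ℕ} (h : a + b < k) : mono a b ∈ degLT k :=
  Submodule.subset_span ⟨a, b, h, rfl⟩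

theorem degLT_mono {j k : ℕ} (h : j ≤ k) : degLT j ≤ degLT k :=
  Submodule.span_mono fun _ ⟨a, b, hab, hp⟩ => ⟨a, b, hab.trans_le h, hp⟩

theorem mul_mono_mem_degLT {p : MvPolynomial (Fin 2) ℂ} {k : ℕ} (hp : p ∈ degLT k) {c d m : ℕ}
    (h : k + c + d ≤ m) : p * mono c d ∈ degLT m := by
  induction hp using Submodule.span_induction with
  | mem x hx =>
    obtain ⟨a, b, hab, rfl⟩ := hx
    rw [mono_mul]
    exact mono_mem_degLT (by omega)
  | zero => simp
  | add x y _ _ hx hy => rw [add_mul]; exact Submodule.add_mem _ hx hy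
  | smul r x _ hx => rw [smul_mul_assoc]; exact Submodule.smul_mem _ r hx

theorem mul_mem_degLT {p q : MvPolynomial (Fin 2) ℂ} {k m n : ℕ} (hp : p ∈ degLT k)
    (hq : q ∈ degLT m) (h : k + m ≤ n + 1) : p * q ∈ degLT n := by
  induction hq using Submodule.span_induction with
  | mem x hx =>
    obtain ⟨a, b, hab, rfl⟩ := hx
    exact mul_mono_mem_degLT hp (by omega)
  | zero => simp
  | add x y _ _ hx hy => rw [mul_add]; exact Submodule.add_mem _ hx hy
  | smul r x _ hx => rw [mul_smul_comm]; exact Submodule.smul_mem _ r hx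

theorem C_mul_mem_degLT {p : MvPolynomial (Fin 2) ℂ} {k : ℕ} (c : ℂ) (hp : p ∈ degLT k) :
    C c * p ∈ degLT k := by
  rw [← smul_eq_C_mul]; exact Submodule.smul_mem _ c hp

/-- A polynomial splits into its homogeneous part of top degree and a remainder. -/
theorem exists_sub_sum_mem_degLT {p : MvPolynomial (Fin 2) ℂ} {k : ℕ} (hp : p ∈ degLT (k + 1)) :
    ∃ c : ℕ → ℂ, p - ∑ a ∈ Finset.range (k + 1), C (c a) * mono a (k - a) ∈ degLT k := by
  induction hp using Submodule.span_induction with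
  | mem x hx =>
    obtain ⟨a, b, hab, rfl⟩ := hx
    rcases Nat.lt_succ_iff_lt_or_eq.1 hab with h | h
    · exact ⟨0, by simpa using mono_mem_degLT h⟩
    · refine ⟨fun i => if i = a then 1 else 0, ?_⟩
      rw [Finset.sum_eq_single a (fun i _ hi => by simp [hi])
        (fun ha => (ha (Finset.mem_range.2 (by omega))).elim)]
      simp [show k - a = b by omega]
  | zero => exact ⟨0, by simp⟩
  | add x y _ _ hx hy =>
    obtain ⟨c, hc⟩ := hx
    obtain ⟨d, hd⟩ := hy
    refine ⟨c + d, ?_⟩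
    convert Submodule.add_mem _ hc hd using 1
    simp only [Pi.add_apply, C_add, add_mul, Finset.sum_add_distrib]
    ring
  | smul r x _ hx =>
    obtain ⟨c, hc⟩ := hx
    refine ⟨r • c, ?_⟩
    convert Submodule.smul_mem _ r hc using 1
    simp only [Pi.smul_apply, smul_eq_mul, C_mul, smul_sub, Finset.smul_sum, smul_eq_C_mul,
      mul_assoc]

/-- `E` takes the values `∫ z^a z̄^b dm` on the monomials, where `dm` is the normalized measure
`a_μ W_μ dx dy` on the disk and `lam = μ + 1/2`. -/
def IsDiskMoment (lam : ℝ) (E : MvPolynomial (Fin 2) ℂ →ₗ[ℂ] ℂ) : Prop :=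
  ∀ a b, E (mono a b) = if a = b then ((a.factorial / risingFac (lam + 1) a : ℝ) : ℂ) else 0

theorem E_C_mul (E : MvPolynomial (Fin 2) ℂ →ₗ[ℂ] ℂ) (c : ℂ) (p : MvPolynomial (Fin 2) ℂ) :
    E (C c * p) = c * E p := by
  rw [← smul_eq_C_mul, map_smul, smul_eq_mul]

theorem eq_zero_of_mem_degLT {L : MvPolynomial (Fin 2) ℂ →ₗ[ℂ] ℂ} {k : ℕ}
    (h : ∀ a b, a + b < k → L (mono a b) = 0) {p : MvPolynomial (Fin 2) ℂ} (hp : p ∈ degLT k) :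
    L p = 0 := by
  have : degLT k ≤ LinearMap.ker L := Submodule.span_le.2 (by
    rintro _ ⟨a, b, hab, rfl⟩
    exact h a b hab)
  exact this hp

section Moments

variable {lam : ℝ} {E : MvPolynomial (Fin 2) ℂ →ₗ[ℂ] ℂ}

theorem IsDiskMoment.one_sub_pow (hlam : 0 < lam) (hE : IsDiskMoment lam E) (j p q : ℕ) :
    E ((1 - mono 1 1) ^ j * mono p q) =
      if p = q then ((p.factorial * risingFac lam j / risingFac (lam + 1) (p + j) : ℝ) : ℂ)
      else 0 := by
  induction j generalizing p q with
  | zero => simp [hE p q, risingFac_zero]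
  | succ j ih =>
    have e : (1 - mono 1 1) ^ (j + 1) * mono p q
        = (1 - mono 1 1) ^ j * mono p q - (1 - mono 1 1) ^ j * mono (p + 1) (q + 1) := by
      rw [← mono_mul p q 1 1]; ring
    rw [e, map_sub, ih, ih]
    by_cases h : p = q
    · subst h
      simp only [if_true]
      rw [← Complex.ofReal_sub]
      congr 1
      rw [show p + 1 + j = p + j + 1 by ring, show p + (j + 1) = p + j + 1 by ring,
        risingFac_succ (lam + 1) (p + j), risingFac_succ lam j, Nat.factorial_succ]
      have h1 := (risingFac_pos (by positivity : 0 < lam + 1) (p + j)).ne'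
      have h2 : lam + 1 + ((p + j : ℕ) : ℝ) ≠ 0 := by positivity
      push_cast at h2 ⊢
      field_simp
      ring
    · simp [h]

/-- The coefficient of `(1 - zw)^j z^(a-j) w^(b-j)` in `zernike lam a b`. -/
noncomputable def zernikeCoeff (lam : ℝ) (a b j : ℕ) : ℝ :=
  (-1) ^ j * (a.choose j * (b.descFactorial j / risingFac lam j))

/-- The disk (Zernike) polynomial of bidegree `(a, b)`, normalized to take the value
`e^{i(a-b)φ}` at `e^{iφ}`. This form is symmetric in `(z, a)` and `(w, b)`; the terms with `j > b`
have coefficient zero. -/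
noncomputable def zernike (lam : ℝ) (a b : ℕ) : MvPolynomial (Fin 2) ℂ :=
  ∑ j ∈ Finset.range (a + 1),
    C (zernikeCoeff lam a b j : ℂ) * ((1 - mono 1 1) ^ j * mono (a - j) (b - j))

theorem zernikeCoeff_of_lt {a b j : ℕ} (h : b < j) : zernikeCoeff lam a b j = 0 := by
  simp [zernikeCoeff, Nat.descFactorial_of_lt h]

theorem IsDiskMoment.zernike_mul_mono_of_ne (hlam : 0 < lam) (hE : IsDiskMoment lam E)
    {a b c d : ℕ} (h : a + c ≠ b + d) : E (zernike lam a b * mono c d) = 0 := by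
  rw [zernike, Finset.sum_mul, map_sum]
  refine Finset.sum_eq_zero fun j hj => ?_
  rw [mul_assoc, mul_assoc, mono_mul, E_C_mul, hE.one_sub_pow hlam]
  have hj' := Finset.mem_range.1 hj
  rcases le_or_gt j b with hb | hb
  · rw [if_neg (by omega), mul_zero]
  · simp [zernikeCoeff_of_lt hb]

/-- The moments of a disk polynomial; for `d < a`, which includes all `c + d < a + b`, they
vanish. -/
theorem IsDiskMoment.zernike_mul_mono (hlam : 0 < lam) (hE : IsDiskMoment lam E)
    {a b c d : ℕ} (h : a + c = b + d) : E (zernike lam a b * mono c d) =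
      ((b.factorial * d.factorial / risingFac (lam + 1) (a + c) *
        if a ≤ d then (c.choose (d - a) : ℝ) else 0 : ℝ) : ℂ) := by
  rw [← sum_alternating_choose, Finset.mul_sum, zernike, Finset.sum_mul, map_sum,
    Complex.ofReal_sum]
  refine Finset.sum_congr rfl fun j hj => ?_
  rw [mul_assoc, mul_assoc, mono_mul, E_C_mul, hE.one_sub_pow hlam]
  have hj' := Finset.mem_range.1 hj
  rcases le_or_gt j b with hb | hb
  · rw [if_pos (by omega), ← Complex.ofReal_mul]
    congr 1
    rw [show a - j + c + j = a + c by omega, zernikeCoeff]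
    have h1 := (risingFac_pos hlam j).ne'
    have h2 : ((a + c - j).choose d : ℝ) * d.factorial * (b - j).factorial
        = (a + c - j).factorial := by
      have := Nat.choose_mul_factorial_mul_factorial (n := a + c - j) (k := d) (by omega)
      rw [show a + c - j - d = b - j by omega] at this
      exact_mod_cast this
    have h3 : ((b - j).factorial : ℝ) * b.descFactorial j = b.factorial := by
      exact_mod_cast Nat.factorial_mul_descFactorial hb
    rw [show a - j + c = a + c - j by omega, ← h2, ← h3]
    field_simp
  · rw [zernikeCoeff_of_lt hb, Nat.choose_eq_zero_of_lt (show a + c - j < d by omega)]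
    simp

/-- The polynomial `zernike lam a b` is orthogonal to all polynomials of lower degree. -/
theorem IsDiskMoment.zernike_mul_of_mem_degLT (hlam : 0 < lam) (hE : IsDiskMoment lam E)
    {a b k : ℕ} (hk : k ≤ a + b) {q : MvPolynomial (Fin 2) ℂ} (hq : q ∈ degLT k) :
    E (zernike lam a b * q) = 0 := by
  refine eq_zero_of_mem_degLT (L := E ∘ₗ LinearMap.mulLeft ℂ (zernike lam a b)) ?_ hq
  intro c d hcd
  simp only [LinearMap.comp_apply, LinearMap.mulLeft_apply]
  by_cases h : a + c = b + d
  · rw [hE.zernike_mul_mono hlam h, if_neg (by omega)]; simp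
  · exact hE.zernike_mul_mono_of_ne hlam h

theorem IsDiskMoment.zernike_mul_mono_swap (hlam : 0 < lam) (hE : IsDiskMoment lam E) (a b : ℕ) :
    E (zernike lam a b * mono b a) =
      ((a.factorial * b.factorial / risingFac (lam + 1) (a + b) : ℝ) : ℂ) := by
  rw [hE.zernike_mul_mono hlam (add_comm a b)]
  simp [mul_comm]

theorem one_sub_pow_mul_mono_sub_mem (j p q : ℕ) :
    (1 - mono 1 1) ^ j * mono p q - C ((-1) ^ j) * mono (p + j) (q + j)
      ∈ degLT (p + q + 2 * j) := by
  induction j generalizing p q with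
  | zero => simp
  | succ j ih =>
    have h1 := ih p q
    have h2 := ih (p + 1) (q + 1)
    have h3 : (1 - mono 1 1) ^ j * mono p q ∈ degLT (p + q + 2 * (j + 1)) := by
      have := Submodule.add_mem _ (degLT_mono (show p + q + 2 * j ≤ p + q + 2 * (j + 1) by omega) h1)
        (C_mul_mem_degLT ((-1) ^ j)
          (mono_mem_degLT (show p + j + (q + j) < p + q + 2 * (j + 1) by omega)))
      simpa using this
    have h2' := degLT_mono (show p + 1 + (q + 1) + 2 * j ≤ p + q + 2 * (j + 1) by omega) h2
    convert Submodule.sub_mem _ h3 h2' using 1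
    rw [← mono_mul p q 1 1, show p + (j + 1) = p + 1 + j by ring,
      show q + (j + 1) = q + 1 + j by ring, pow_succ (-1 : ℂ)]
    simp only [mul_neg_one, C_neg]
    ring

/-- The coefficient of `z^a w^b` in `zernike lam a b`. -/
noncomputable def zernikeLead (lam : ℝ) (a b : ℕ) : ℝ :=
  risingFac lam (a + b) / (risingFac lam a * risingFac lam b)

theorem zernikeLead_pos (hlam : 0 < lam) (a b : ℕ) : 0 < zernikeLead lam a b :=
  div_pos (risingFac_pos hlam _) (mul_pos (risingFac_pos hlam _) (risingFac_pos hlam _))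

theorem zernike_sub_lead_mem (hlam : 0 < lam) (a b : ℕ) :
    zernike lam a b - C (zernikeLead lam a b : ℂ) * mono a b ∈ degLT (a + b) := by
  have e : zernikeLead lam a b = ∑ j ∈ Finset.range (a + 1), zernikeCoeff lam a b j * (-1) ^ j := by
    have h := sum_choose_descFactorial_div hlam a b
    have h1 : risingFac (lam + b) a / risingFac lam a = zernikeLead lam a b := by
      rw [zernikeLead, add_comm a b, risingFac_add]
      have := (risingFac_pos hlam b).ne'
      field_simp
    rw [← h1, ← h]
    refine Finset.sum_congr rfl fun j _ => ?_
    have : ((-1 : ℝ) ^ j) * (-1) ^ j = 1 := by rw [← mul_pow]; simp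
    rw [zernikeCoeff]
    linear_combination (-(a.choose j * (b.descFactorial j / risingFac lam j)) : ℝ) * this
  rw [e, zernike, Complex.ofReal_sum, map_sum, Finset.sum_mul, ← Finset.sum_sub_distrib]
  refine Submodule.sum_mem _ fun j hj => ?_
  have hj' := Finset.mem_range.1 hj
  rcases le_or_gt j b with hb | hb
  · have h := C_mul_mem_degLT (zernikeCoeff lam a b j : ℂ)
      (one_sub_pow_mul_mono_sub_mem j (a - j) (b - j))
    rw [show a - j + (b - j) + 2 * j = a + b by omega, show a - j + j = a by omega,
      show b - j + j = b by omega] at h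
    convert h using 1
    push_cast
    simp only [C_mul]
    ring
  · simp [zernikeCoeff_of_lt hb]

/-- The moment functional is nondegenerate on polynomials of bounded degree. -/
theorem IsDiskMoment.eq_zero_of_orthogonal (hlam : 0 < lam) (hE : IsDiskMoment lam E) (k : ℕ)
    {p : MvPolynomial (Fin 2) ℂ} (hp : p ∈ degLT k) (h : ∀ q ∈ degLT k, E (p * q) = 0) :
    p = 0 := by
  induction k with
  | zero => simpa [degLT] using hp
  | succ k ih =>
    obtain ⟨c, hc⟩ := exists_sub_sum_mem_degLT hp
    have hc0 : ∀ a ∈ Finset.range (k + 1), c a = 0 := by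
      intro a ha
      have ha' := Finset.mem_range.1 ha
      have h1 : zernike lam (k - a) a ∈ degLT (k + 1) := by
        have h2 := zernike_sub_lead_mem hlam (k - a) a
        rw [show k - a + a = k by omega] at h2
        have := Submodule.add_mem _ (degLT_mono (Nat.le_succ k) h2)
          (C_mul_mem_degLT (zernikeLead lam (k - a) a : ℂ)
            (mono_mem_degLT (show k - a + a < k + 1 by omega)))
        simpa using this
      have h2 := h _ h1
      have h3 := hE.zernike_mul_of_mem_degLT hlam (show k ≤ k - a + a by omega) hc
      rw [mul_sub, map_sub, mul_comm, h2, Finset.mul_sum, map_sum,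
        Finset.sum_eq_single a, zero_sub, neg_eq_zero, mul_left_comm, E_C_mul,
        hE.zernike_mul_mono_swap hlam] at h3
      · refine (mul_eq_zero.1 h3).resolve_right ?_
        have := risingFac_pos (by positivity : 0 < lam + 1) (k - a + a)
        exact_mod_cast (by positivity : ((k - a).factorial * a.factorial /
          risingFac (lam + 1) (k - a + a) : ℝ) ≠ 0)
      · intro i hi hia
        have hi' := Finset.mem_range.1 hi
        rw [mul_left_comm, E_C_mul, hE.zernike_mul_mono_of_ne hlam (by omega), mul_zero]
      · exact fun h => (h ha).elim
    rw [Finset.sum_eq_zero (fun a ha => by rw [hc0 a ha]; simp), sub_zero] at hc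
    exact ih hc fun q hq => h q (degLT_mono (Nat.le_succ k) hq)

/-- The polynomials of degree `k` orthogonal to all polynomials of lower degree are spanned by the
disk polynomials of bidegree `(a, k - a)`. -/
theorem IsDiskMoment.exists_eq_sum_zernike (hlam : 0 < lam) (hE : IsDiskMoment lam E) {k : ℕ}
    {p : MvPolynomial (Fin 2) ℂ} (hp : p ∈ degLT (k + 1)) (h : ∀ q ∈ degLT k, E (p * q) = 0) :
    ∃ d : ℕ → ℂ, p = ∑ a ∈ Finset.range (k + 1), C (d a) * zernike lam a (k - a) := by
  obtain ⟨c, hc⟩ := exists_sub_sum_mem_degLT hp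
  refine ⟨fun a => c a / (zernikeLead lam a (k - a) : ℂ), ?_⟩
  rw [← sub_eq_zero]
  refine hE.eq_zero_of_orthogonal hlam k ?_ fun q hq => ?_
  · have h2 : ∑ a ∈ Finset.range (k + 1), C (c a / (zernikeLead lam a (k - a) : ℂ)) *
        (zernike lam a (k - a) - C (zernikeLead lam a (k - a) : ℂ) * mono a (k - a)) ∈ degLT k := by
      refine Submodule.sum_mem _ fun a ha => C_mul_mem_degLT _ ?_
      have := zernike_sub_lead_mem hlam a (k - a)
      rwa [show a + (k - a) = k by have := Finset.mem_range.1 ha; omega] at this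
    convert Submodule.sub_mem _ hc h2 using 1
    simp only [mul_sub, Finset.sum_sub_distrib, ← mul_assoc, ← C_mul]
    have : ∀ a, c a / (zernikeLead lam a (k - a) : ℂ) * (zernikeLead lam a (k - a) : ℂ) = c a :=
      fun a => div_mul_cancel₀ _ (by exact_mod_cast (zernikeLead_pos hlam a (k - a)).ne')
    simp only [this]
    ring
  · rw [sub_mul, map_sub, h q hq, Finset.sum_mul, map_sum, zero_sub, neg_eq_zero]
    refine Finset.sum_eq_zero fun a ha => ?_
    rw [mul_assoc, E_C_mul, hE.zernike_mul_of_mem_degLT hlam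
      (by have := Finset.mem_range.1 ha; omega) hq, mul_zero]

end Moments

/-! ### Gegenbauer ridge polynomials -/

/-- The linear form `(u z + v w) / 2`. For `v = e^{iξ}`, `u = e^{-iξ}` and `w = z̄` it is
`x cos ξ + y sin ξ`. -/
noncomputable def lineForm (u v : ℂ) : MvPolynomial (Fin 2) ℂ :=
  C (u / 2) * mono 1 0 + C (v / 2) * mono 0 1

theorem lineForm_mem (u v : ℂ) : lineForm u v ∈ degLT 2 :=
  Submodule.add_mem _ (C_mul_mem_degLT _ (mono_mem_degLT (by omega)))
    (C_mul_mem_degLT _ (mono_mem_degLT (by omega)))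

theorem lineForm_pow_mem (u v : ℂ) (k : ℕ) : lineForm u v ^ k ∈ degLT (k + 1) := by
  induction k with
  | zero => rw [pow_zero, ← mono_zero]; exact mono_mem_degLT (by omega)
  | succ k ih => rw [pow_succ]; exact mul_mem_degLT ih (lineForm_mem u v) (by omega)

theorem lineForm_mul_mono (u v : ℂ) (a b : ℕ) :
    lineForm u v * mono a b = C (u / 2) * mono (a + 1) b + C (v / 2) * mono a (b + 1) := by
  rw [lineForm, add_mul, mul_assoc, mul_assoc, mono_mul, mono_mul, zero_add, zero_add,
    add_comm 1, add_comm 1]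

/-- The ridge polynomial `C_k^lam((u z + v w) / 2)`. -/
noncomputable def ridge (lam : ℝ) (u v : ℂ) (k : ℕ) : MvPolynomial (Fin 2) ℂ :=
  Polynomial.aeval (lineForm u v) (gegenbauer lam k)

theorem ridge_zero (lam : ℝ) (u v : ℂ) : ridge lam u v 0 = 1 := by simp [ridge, gegenbauer]

theorem ridge_one (lam : ℝ) (u v : ℂ) :
    ridge lam u v 1 = C ((2 * lam : ℝ) : ℂ) * lineForm u v := by
  rw [ridge, gegenbauer, map_mul, Polynomial.aeval_C, Polynomial.aeval_X]
  rfl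

theorem ridge_succ_succ (lam : ℝ) (u v : ℂ) (k : ℕ) :
    ridge lam u v (k + 2) =
      C ((2 * (k + 1 + lam) / (k + 2) : ℝ) : ℂ) * (ridge lam u v (k + 1) * lineForm u v)
        - C (((k + 2 * lam) / (k + 2) : ℝ) : ℂ) * ridge lam u v k := by
  rw [ridge, gegenbauer, map_sub, map_mul, map_mul, map_mul, Polynomial.aeval_C,
    Polynomial.aeval_C, Polynomial.aeval_X, mul_assoc, mul_comm (lineForm u v)]
  rfl

theorem ridge_sub_lead_mem (lam : ℝ) (u v : ℂ) (k : ℕ) :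
    ridge lam u v k - C ((2 ^ k * risingFac lam k / k.factorial : ℝ) : ℂ) * lineForm u v ^ k
      ∈ degLT k := by
  induction k using Nat.twoStepInduction with
  | zero => simp [ridge_zero, risingFac_zero]
  | one => simp [ridge_one, risingFac_succ, risingFac_zero]
  | more k ih0 ih1 =>
    have h0 : ridge lam u v k ∈ degLT (k + 2) := by
      have := Submodule.add_mem _ (degLT_mono (show k ≤ k + 2 by omega) ih0)
        (C_mul_mem_degLT ((2 ^ k * risingFac lam k / k.factorial : ℝ) : ℂ)
          (degLT_mono (show k + 1 ≤ k + 2 by omega) (lineForm_pow_mem u v k)))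
      simpa using this
    have h1 := mul_mem_degLT ih1 (lineForm_mem u v) (show k + 1 + 2 ≤ k + 2 + 1 by omega)
    have h2 := Submodule.sub_mem _
      (C_mul_mem_degLT ((2 * (k + 1 + lam) / (k + 2) : ℝ) : ℂ) h1)
      (C_mul_mem_degLT (((k + 2 * lam) / (k + 2) : ℝ) : ℂ) h0)
    convert h2 using 1
    have e : (2 ^ (k + 2) * risingFac lam (k + 2) / (k + 2).factorial : ℝ) =
        (2 * (k + 1 + lam) / (k + 2)) * (2 ^ (k + 1) * risingFac lam (k + 1) /
          (k + 1).factorial) := by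
      rw [show k + 2 = k + 1 + 1 by ring, risingFac_succ, Nat.factorial_succ (k + 1)]
      push_cast
      field_simp
      ring
    rw [ridge_succ_succ, e, Complex.ofReal_mul, C_mul]
    ring

theorem map_mul_lineForm_mul_mono (E : MvPolynomial (Fin 2) ℂ →ₗ[ℂ] ℂ) (u v : ℂ)
    (p : MvPolynomial (Fin 2) ℂ) (a b : ℕ) :
    E (p * (lineForm u v * mono a b)) =
      u / 2 * E (p * mono (a + 1) b) + v / 2 * E (p * mono a (b + 1)) := by
  rw [lineForm_mul_mono, mul_add, map_add, mul_left_comm, E_C_mul, mul_left_comm, E_C_mul]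

theorem map_ridge_succ_succ_mul (E : MvPolynomial (Fin 2) ℂ →ₗ[ℂ] ℂ) (lam : ℝ) (u v : ℂ) (k : ℕ)
    (q : MvPolynomial (Fin 2) ℂ) :
    E (ridge lam u v (k + 2) * q) =
      ((2 * (k + 1 + lam) / (k + 2) : ℝ) : ℂ) * E (ridge lam u v (k + 1) * (lineForm u v * q)) -
        (((k + 2 * lam) / (k + 2) : ℝ) : ℂ) * E (ridge lam u v k * q) := by
  rw [← E_C_mul, ← E_C_mul, ← map_sub, ridge_succ_succ]
  congr 1
  ring

section Moments

variable {lam : ℝ} {E : MvPolynomial (Fin 2) ℂ →ₗ[ℂ] ℂ} {u v : ℂ}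

theorem IsDiskMoment.zernike_mul_lineForm_pow (hlam : 0 < lam) (hE : IsDiskMoment lam E)
    (a b : ℕ) : E (zernike lam a b * lineForm u v ^ (a + b)) =
      (((a + b).factorial / (2 ^ (a + b) * risingFac (lam + 1) (a + b)) : ℝ) : ℂ)
        * (v ^ a * u ^ b) := by
  rw [lineForm, add_pow, Finset.mul_sum, map_sum, Finset.sum_eq_single b]
  · have e : zernike lam a b * ((C (u / 2) * mono 1 0) ^ b * (C (v / 2) * mono 0 1) ^ (a + b - b) *
        ((a + b).choose b : MvPolynomial (Fin 2) ℂ)) =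
        C ((u / 2) ^ b * (v / 2) ^ a * ((a + b).choose b : ℂ)) * (zernike lam a b * mono b a) := by
      rw [Nat.add_sub_cancel, mul_pow, mul_pow, mono_pow, mono_pow, one_mul, zero_mul, one_mul,
        zero_mul, show mono b a = mono b 0 * mono 0 a by rw [mono_mul, add_zero, zero_add],
        C_mul, C_mul, C_pow, C_pow, map_natCast]
      ring
    rw [e, E_C_mul, hE.zernike_mul_mono_swap hlam]
    have h1 : (((a + b).choose b : ℝ) * b.factorial * a.factorial) = (a + b).factorial := by
      have := Nat.choose_mul_factorial_mul_factorial (show b ≤ a + b by omega)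
      rw [Nat.add_sub_cancel] at this
      exact_mod_cast this
    rw [← h1]
    push_cast
    rw [div_pow, div_pow, pow_add]
    field_simp
  · intro m hm hmb
    have hm' := Finset.mem_range.1 hm
    have e : zernike lam a b * ((C (u / 2) * mono 1 0) ^ m * (C (v / 2) * mono 0 1) ^ (a + b - m) *
        ((a + b).choose m : MvPolynomial (Fin 2) ℂ)) =
        C ((u / 2) ^ m * (v / 2) ^ (a + b - m) * ((a + b).choose m : ℂ)) *
          (zernike lam a b * mono m (a + b - m)) := by
      rw [mul_pow, mul_pow, mono_pow, mono_pow, one_mul, zero_mul, one_mul,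
        zero_mul, show mono m (a + b - m) = mono m 0 * mono 0 (a + b - m) by
          rw [mono_mul, add_zero, zero_add],
        C_mul, C_mul, C_pow, C_pow, map_natCast]
      ring
    rw [e, E_C_mul, hE.zernike_mul_mono_of_ne hlam (by omega), mul_zero]
  · intro h
    exact (h (Finset.mem_range.2 (by omega))).elim

/-- The evaluation of `zernike lam a b` on the unit circle is, up to the factor `lam / (k + lam)`,
integration against the ridge polynomial of degree `k = a + b`; only the leading part of the latter
contributes. -/
theorem IsDiskMoment.ridge_mul_zernike (hlam : 0 < lam) (hE : IsDiskMoment lam E) {a b k : ℕ}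
    (hk : a + b = k) :
    E (ridge lam u v k * zernike lam a b) = ((lam / (k + lam) : ℝ) : ℂ) * (v ^ a * u ^ b) := by
  subst hk
  have h := hE.zernike_mul_of_mem_degLT hlam (le_refl (a + b)) (ridge_sub_lead_mem lam u v (a + b))
  rw [mul_sub, map_sub, sub_eq_zero, mul_left_comm, E_C_mul,
    hE.zernike_mul_lineForm_pow hlam] at h
  rw [mul_comm, h, ← mul_assoc, ← Complex.ofReal_mul]
  congr 2
  have h1 := risingFac_succ lam (a + b)
  rw [risingFac_succ'] at h1
  have h2 := (risingFac_pos (by positivity : 0 < lam + 1) (a + b)).ne'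
  have h3 : ((a + b : ℕ) : ℝ) + lam ≠ 0 := by positivity
  field_simp
  linear_combination -h1

theorem IsDiskMoment.ridge_mul_mono_of_odd (hE : IsDiskMoment lam E) (k : ℕ) :
    ∀ a b : ℕ, Odd (k + a + b) → E (ridge lam u v k * mono a b) = 0 := by
  have h0 : ∀ a b : ℕ, Odd (a + b) → E (mono a b) = 0 := by
    intro a b h
    rw [hE, if_neg]
    rintro rfl
    exact (Nat.not_odd_iff_even.2 (Even.add_self a)) h
  induction k using Nat.twoStepInduction with
  | zero => intro a b h; rw [ridge_zero, one_mul]; exact h0 a b (by simpa using h)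
  | one =>
    intro a b h
    rw [ridge_one, mul_assoc, E_C_mul, lineForm_mul_mono, map_add, E_C_mul, E_C_mul,
      h0 _ _ (by convert h using 1; ring), h0 _ _ (by convert h using 1; ring)]
    simp
  | more k ih0 ih1 =>
    intro a b h
    have h' : Odd (k + a + b) := by
      rw [Nat.odd_iff] at h ⊢; omega
    rw [map_ridge_succ_succ_mul, map_mul_lineForm_mul_mono, ih0 a b h', ih1 _ _ (by convert h using 1; ring), ih1 _ _ (by convert h using 1; ring)]
    simp

/-- Ridge polynomials are orthogonal to all polynomials of lower degree. In the induction on the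
three-term recurrence only the monomials of degree `k` need an argument for `C_{k+2}`: there both
terms of the recurrence contribute, and the values from `IsDiskMoment.ridge_mul_zernike` cancel. -/
theorem IsDiskMoment.ridge_mul_of_mem_degLT (hlam : 0 < lam) (hE : IsDiskMoment lam E)
    (huv : u * v = 1) (k : ℕ) :
    ∀ q ∈ degLT k, E (ridge lam u v k * q) = 0 := by
  -- the pairing with monomials of top degree, known once orthogonality is
  have top : ∀ k, (∀ q ∈ degLT k, E (ridge lam u v k * q) = 0) → ∀ a b, a + b = k →
      E (ridge lam u v k * mono a b) =
        ((lam / (k + lam) / zernikeLead lam a b : ℝ) : ℂ) * (v ^ a * u ^ b) := by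
    intro k hk a b hab
    have h1 := zernike_sub_lead_mem hlam a b
    rw [hab] at h1
    have h2 := hk _ h1
    rw [mul_sub, map_sub, sub_eq_zero, hE.ridge_mul_zernike hlam hab,
      mul_left_comm (ridge lam u v k), E_C_mul] at h2
    have h3 : (zernikeLead lam a b : ℂ) ≠ 0 := by exact_mod_cast (zernikeLead_pos hlam a b).ne'
    rw [Complex.ofReal_div, div_mul_eq_mul_div, h2, mul_div_cancel_left₀ _ h3]
  induction k using Nat.twoStepInduction with
  | zero => intro q hq; rw [show q = 0 by simpa [degLT] using hq]; simp
  | one =>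
    intro q hq
    refine eq_zero_of_mem_degLT (L := E ∘ₗ LinearMap.mulLeft ℂ _) ?_ hq
    intro a b hab
    exact hE.ridge_mul_mono_of_odd 1 a b (by rw [Nat.odd_iff]; omega)
  | more k ih0 ih1 =>
    intro q hq
    refine eq_zero_of_mem_degLT (L := E ∘ₗ LinearMap.mulLeft ℂ _) ?_ hq
    intro a b hab
    simp only [LinearMap.comp_apply, LinearMap.mulLeft_apply]
    rcases Nat.lt_trichotomy (a + b) k with h | h | h
    · rw [map_ridge_succ_succ_mul, ih0 _ (mono_mem_degLT h),
        ih1 _ (mul_mono_mem_degLT (lineForm_mem u v) (by omega))]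
      simp
    · rw [map_ridge_succ_succ_mul, map_mul_lineForm_mul_mono, top k ih0 a b h, top (k + 1) ih1 (a + 1) b (by omega),
        top (k + 1) ih1 a (b + 1) (by omega)]
      have e : ((2 * (k + 1 + lam) / (k + 2) : ℝ) : ℂ) *
          (u / 2 * (((lam / ((k + 1 : ℕ) + lam) / zernikeLead lam (a + 1) b : ℝ) : ℂ)
              * (v ^ (a + 1) * u ^ b)) +
            v / 2 * (((lam / ((k + 1 : ℕ) + lam) / zernikeLead lam a (b + 1) : ℝ) : ℂ)
              * (v ^ a * u ^ (b + 1)))) =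
          (((2 * (k + 1 + lam) / (k + 2)) * ((lam / ((k + 1 : ℕ) + lam)) / 2 *
            (1 / zernikeLead lam (a + 1) b + 1 / zernikeLead lam a (b + 1))) : ℝ) : ℂ)
              * (v ^ a * u ^ b) := by
        push_cast
        linear_combination ((2 * (k + 1 + lam) / (k + 2) : ℂ) * (lam / (k + 1 + lam)) / 2 *
          (1 / zernikeLead lam (a + 1) b + 1 / zernikeLead lam a (b + 1)) * (v ^ a * u ^ b)) * huv
      rw [e, ← mul_assoc ((_ : ℝ) : ℂ) ((_ : ℝ) : ℂ), ← sub_mul, ← Complex.ofReal_mul, ← Complex.ofReal_sub]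
      convert zero_mul _
      rw [Complex.ofReal_eq_zero]
      have hk : ((a + b : ℕ) : ℝ) = k := by exact_mod_cast h
      simp only [zernikeLead, show a + 1 + b = a + b + 1 by ring, ← add_assoc a b 1,
        risingFac_succ, hk]
      push_cast at hk
      have h1 := (risingFac_pos hlam a).ne'
      have h2 := (risingFac_pos hlam b).ne'
      have h3 := (risingFac_pos hlam (a + b)).ne'
      have h4 : lam + k ≠ 0 := by positivity
      have h5 : (k : ℝ) + lam ≠ 0 := by positivity
      have h6 : (k : ℝ) + 1 + lam ≠ 0 := by positivity
      have h7 : lam + a ≠ 0 := by positivity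
      have h8 : lam + b ≠ 0 := by positivity
      push_cast
      rw [← hk] at *
      field_simp
      ring
    · exact hE.ridge_mul_mono_of_odd (k + 2) a b (by rw [Nat.odd_iff]; omega)

end Moments

/-! ### The moments of the disk -/

theorem intervalIntegrable_one_sub_sq_rpow {s : ℝ} (hs : -1 < s) {g : ℝ → ℝ} (hg : Continuous g) :
    IntervalIntegrable (fun r => g r * (1 - r ^ 2) ^ s) volume 0 1 := by
  have h1 : IntervalIntegrable (fun r : ℝ => (1 - r) ^ s) volume 0 1 := by
    have := (intervalIntegral.intervalIntegrable_rpow' (a := 1) (b := 0) hs).comp_sub_left 1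
    simpa using this
  have h2 : ContinuousOn (fun r : ℝ => g r * (1 + r) ^ s) (Set.uIcc 0 1) := by
    refine hg.continuousOn.mul (ContinuousOn.rpow_const (by fun_prop) fun r hr => Or.inl ?_)
    rw [Set.uIcc_of_le zero_le_one] at hr
    linarith [hr.1]
  refine (h1.continuousOn_mul h2).congr fun r hr => ?_
  rw [Set.uIoc_of_le zero_le_one] at hr
  rw [show 1 - r ^ 2 = (1 + r) * (1 - r) by ring,
    Real.mul_rpow (by linarith [hr.1]) (by linarith [hr.2]), mul_assoc]

/-- The radial moments, by induction from the vanishing of the integral of the derivative of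
`r^(2a) (1 - r²)^lam`. -/
theorem integral_pow_mul_one_sub_sq_rpow {lam : ℝ} (hlam : 0 < lam) (a : ℕ) :
    2 * lam * ∫ r in (0 : ℝ)..1, r ^ (2 * a + 1) * (1 - r ^ 2) ^ (lam - 1) =
      a.factorial / risingFac (lam + 1) a := by
  have hint : ∀ m : ℕ, IntervalIntegrable (fun r : ℝ => r ^ m * (1 - r ^ 2) ^ (lam - 1))
      volume 0 1 := fun m => intervalIntegrable_one_sub_sq_rpow (by linarith) (by fun_prop)
  have hpos : ∀ r ∈ Set.Ioo (0 : ℝ) 1, 0 < 1 - r ^ 2 := fun r hr => by nlinarith [hr.1, hr.2]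
  have hcont : Continuous fun r : ℝ => (1 - r ^ 2) ^ lam :=
    Continuous.rpow_const (by fun_prop) fun _ => Or.inr hlam.le
  have hder : ∀ r ∈ Set.Ioo (0 : ℝ) 1, HasDerivAt (fun r : ℝ => (1 - r ^ 2) ^ lam)
      (-(2 * lam) * (r * (1 - r ^ 2) ^ (lam - 1))) r := by
    intro r hr
    have h1 : HasDerivAt (fun r : ℝ => 1 - r ^ 2) (-(2 * r)) r := by
      simpa using (hasDerivAt_pow 2 r).const_sub 1
    convert h1.rpow_const (p := lam) (Or.inl (hpos r hr).ne') using 1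
    ring
  induction a with
  | zero =>
    have h := intervalIntegral.integral_eq_sub_of_hasDerivAt_of_le zero_le_one
      hcont.continuousOn hder (by simpa using (hint 1).const_mul (-(2 * lam)))
    rw [intervalIntegral.integral_const_mul] at h
    simp [Real.zero_rpow hlam.ne'] at h
    simp [risingFac_zero]
    linarith
  | succ a ih =>
    have h := intervalIntegral.integral_eq_sub_of_hasDerivAt_of_le zero_le_one
      (f := fun r : ℝ => r ^ (2 * a + 2) * (1 - r ^ 2) ^ lam)
      (f' := fun r => (2 * a + 2) * (r ^ (2 * a + 1) * (1 - r ^ 2) ^ (lam - 1)) -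
        (2 * a + 2 + 2 * lam) * (r ^ (2 * (a + 1) + 1) * (1 - r ^ 2) ^ (lam - 1)))
      (by fun_prop) (fun r hr => by
        refine ((hasDerivAt_pow (2 * a + 2) r).mul (hder r hr)).congr_deriv ?_
        have e : (1 - r ^ 2) ^ lam = (1 - r ^ 2) * (1 - r ^ 2) ^ (lam - 1) := by
          rw [mul_comm, ← Real.rpow_add_one (hpos r hr).ne']; congr 1; ring
        rw [e, show 2 * a + 2 - 1 = 2 * a + 1 by omega]
        push_cast
        ring)
      (((hint _).const_mul _).sub ((hint _).const_mul _))
    rw [intervalIntegral.integral_sub ((hint _).const_mul _) ((hint _).const_mul _),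
      intervalIntegral.integral_const_mul, intervalIntegral.integral_const_mul] at h
    simp [Real.zero_rpow hlam.ne'] at h
    have h1 := (risingFac_pos (by positivity : 0 < lam + 1) a).ne'
    have h2 : lam + 1 + a ≠ 0 := by positivity
    rw [risingFac_succ, Nat.factorial_succ]
    rw [eq_div_iff h1] at ih
    rw [eq_div_iff (mul_ne_zero h1 h2)]
    push_cast
    rw [← ih]
    linear_combination (-(lam * risingFac (lam + 1) a)) * h

theorem integral_exp_int_mul (j : ℤ) :
    ∫ φ in Set.Ioo (-Real.pi) Real.pi, Complex.exp (j * Complex.I * φ) =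
      if j = 0 then ((2 * Real.pi : ℝ) : ℂ) else 0 := by
  rw [← integral_Ioc_eq_integral_Ioo, ← intervalIntegral.integral_of_le
    (by linarith [Real.pi_pos])]
  split_ifs with h
  · subst h
    simp
    ring
  · have hc : (j : ℂ) * Complex.I ≠ 0 := mul_ne_zero (by exact_mod_cast h) Complex.I_ne_zero
    rw [integral_exp_mul_complex hc]
    have : Complex.exp (j * Complex.I * (Real.pi : ℝ)) =
        Complex.exp (j * Complex.I * ((-Real.pi : ℝ) : ℂ)) := by
      rw [Complex.exp_eq_exp_iff_exists_int]
      exact ⟨j, by push_cast; ring⟩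
    rw [this, sub_self, zero_div]

theorem measurableSet_disk : MeasurableSet disk :=
  measurableSet_le (by fun_prop) (by fun_prop)

theorem measurable_weight (μ : ℝ) : Measurable (weight μ) := by
  unfold weight; fun_prop

theorem aConst_pos {μ : ℝ} (hμ : 0 ≤ μ) : 0 < aConst μ := by
  unfold aConst; have := Real.pi_pos; positivity

theorem weight_nonneg {μ : ℝ} {p : ℝ × ℝ} (hp : p ∈ disk) : 0 ≤ weight μ p :=
  Real.rpow_nonneg (by have : p.1 ^ 2 + p.2 ^ 2 ≤ 1 := hp; linarith) _

theorem integral_diskMeasure {F : Type*} [NormedAddCommGroup F] [NormedSpace ℝ F] {μ : ℝ}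
    (hμ : 0 ≤ μ) (g : ℝ × ℝ → F) :
    ∫ p, g p ∂(diskMeasure μ) = ∫ p in disk, (aConst μ * weight μ p) • g p := by
  rw [diskMeasure, integral_withDensity_eq_integral_toReal_smul]
  · refine setIntegral_congr_fun measurableSet_disk fun p hp => ?_
    rw [ENNReal.toReal_ofReal (mul_nonneg (aConst_pos hμ).le (weight_nonneg hp))]
  · exact ((measurable_weight μ).const_mul _).ennreal_ofReal
  · exact Filter.Eventually.of_forall fun _ => ENNReal.ofReal_lt_top

theorem integrable_diskMeasure_iff {F : Type*} [NormedAddCommGroup F] [NormedSpace ℝ F] {μ : ℝ}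
    (hμ : 0 ≤ μ) (g : ℝ × ℝ → F) :
    Integrable g (diskMeasure μ) ↔ IntegrableOn (fun p => (aConst μ * weight μ p) • g p) disk := by
  rw [diskMeasure, integrable_withDensity_iff_integrable_smul'
    ((measurable_weight μ).const_mul _).ennreal_ofReal
    (Filter.Eventually.of_forall fun _ => ENNReal.ofReal_lt_top)]
  refine integrableOn_congr_fun (fun p hp => ?_) measurableSet_disk
  rw [ENNReal.toReal_ofReal (mul_nonneg (aConst_pos hμ).le (weight_nonneg hp))]

/-- The point `(x, y)` of the plane as the complex number `x + iy`. -/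
noncomputable def toC (p : ℝ × ℝ) : ℂ := ⟨p.1, p.2⟩

theorem integral_monomial_diskMeasure {μ : ℝ} (hμ : 0 ≤ μ) (a b : ℕ) :
    ∫ p, toC p ^ a * (starRingEnd ℂ (toC p)) ^ b ∂(diskMeasure μ) =
      if a = b then ((a.factorial / risingFac (μ + 1 / 2 + 1) a : ℝ) : ℂ) else 0 := by
  rw [integral_diskMeasure hμ, ← integral_indicator measurableSet_disk,
    ← integral_comp_polarCoord_symm, polarCoord_target]
  have e : ∀ p ∈ (Set.Ioi (0 : ℝ)) ×ˢ Set.Ioo (-Real.pi) Real.pi,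
      p.1 • disk.indicator (fun p => (aConst μ * weight μ p) •
        (toC p ^ a * (starRingEnd ℂ (toC p)) ^ b)) (polarCoord.symm p) =
      (Set.Iic (1 : ℝ)).indicator (fun r => ((aConst μ * (r ^ (a + b + 1) *
        (1 - r ^ 2) ^ (μ + 1 / 2 - 1)) : ℝ) : ℂ)) p.1 *
        Complex.exp (((a - b : ℤ) : ℂ) * Complex.I * p.2) := by
    rintro ⟨r, φ⟩ ⟨hr, -⟩
    have hr' : 0 < r := hr
    have hsq : (r * Real.cos φ) ^ 2 + (r * Real.sin φ) ^ 2 = r ^ 2 := by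
      linear_combination r ^ 2 * Real.cos_sq_add_sin_sq φ
    have hmem : (r * Real.cos φ, r * Real.sin φ) ∈ disk ↔ r ∈ Set.Iic (1 : ℝ) := by
      simp only [disk, Set.mem_ofPred_eq, hsq, Set.mem_Iic]
      exact sq_le_one_iff₀ hr'.le
    simp only [polarCoord_symm_apply]
    by_cases h : r ∈ Set.Iic (1 : ℝ)
    · rw [Set.indicator_of_mem (hmem.2 h), Set.indicator_of_mem h]
      have hz : toC (r * Real.cos φ, r * Real.sin φ) = r * Complex.exp (φ * Complex.I) := by
        rw [Complex.exp_mul_I]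
        apply Complex.ext <;> simp [toC, ← Complex.ofReal_cos, ← Complex.ofReal_sin]
      have hw : (starRingEnd ℂ) (toC (r * Real.cos φ, r * Real.sin φ)) =
          r * Complex.exp (-(φ * Complex.I)) := by
        rw [hz, map_mul, Complex.conj_ofReal, ← Complex.exp_conj]; simp
      rw [hw, hz, mul_pow, mul_pow, ← Complex.exp_nat_mul, ← Complex.exp_nat_mul]
      have he : Complex.exp (((a - b : ℤ) : ℂ) * Complex.I * φ) =
          Complex.exp (a * (φ * Complex.I)) * Complex.exp (b * -(φ * Complex.I)) := by
        rw [← Complex.exp_add]; congr 1; push_cast; ring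
      rw [he, weight, show 1 - (r * Real.cos φ) ^ 2 - (r * Real.sin φ) ^ 2 = 1 - r ^ 2 by linarith,
        show μ + 1 / 2 - 1 = μ - 1 / 2 by ring]
      simp only [Complex.real_smul]
      push_cast
      ring
    · rw [Set.indicator_of_notMem (fun h' => h (hmem.1 h')), Set.indicator_of_notMem h]
      simp
  rw [setIntegral_congr_fun (measurableSet_Ioi.prod measurableSet_Ioo) e, Measure.volume_eq_prod,
    setIntegral_prod_mul ((Set.Iic (1 : ℝ)).indicator fun r => ((aConst μ * (r ^ (a + b + 1) *
      (1 - r ^ 2) ^ (μ + 1 / 2 - 1)) : ℝ) : ℂ))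
      (fun φ : ℝ => Complex.exp (((a - b : ℤ) : ℂ) * Complex.I * φ)), integral_exp_int_mul]
  by_cases h : a = b
  · subst h
    rw [if_pos (by simp), if_pos rfl, setIntegral_indicator measurableSet_Iic,
      Set.Ioi_inter_Iic, integral_complex_ofReal, integral_const_mul,
      ← intervalIntegral.integral_of_le zero_le_one, ← Complex.ofReal_mul]
    congr 1
    rw [← integral_pow_mul_one_sub_sq_rpow (by positivity), aConst, ← two_mul]
    have := Real.pi_pos.ne'
    field_simp
  · rw [if_neg (by omega), if_neg h, mul_zero]

theorem isFiniteMeasure_diskMeasure {μ : ℝ} (hμ : 0 ≤ μ) : IsFiniteMeasure (diskMeasure μ) := by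
  have h := integral_monomial_diskMeasure hμ 0 0
  -- a Bochner integral with nonzero value can only be that of an integrable function
  have h1 : Integrable (fun _ : ℝ × ℝ => (1 : ℂ)) (diskMeasure μ) := by
    refine Integrable.of_integral_ne_zero ?_
    simp only [pow_zero, mul_one, risingFac_zero] at h
    rw [h]
    simp
  exact (integrable_const_iff_isFiniteMeasure one_ne_zero).1 h1

/-! ### Integration over chords of the disk -/

/-- The rotation by the angle `θ` in real coordinates. -/
noncomputable def rot (θ : ℝ) (p : ℝ × ℝ) : ℝ × ℝ :=
  (p.1 * Real.cos θ - p.2 * Real.sin θ, p.1 * Real.sin θ + p.2 * Real.cos θ)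

theorem measurePreserving_rot (θ : ℝ) : MeasurePreserving (rot θ) volume volume := by
  have h1 := (rotation (Circle.exp θ)).measurePreserving
  have h2 := Complex.volume_preserving_equiv_real_prod
  have h := (h2.comp h1).comp h2.symm
  have e : rot θ = (Complex.measurableEquivRealProd ∘ rotation (Circle.exp θ)) ∘
      Complex.measurableEquivRealProd.symm := by
    funext p
    apply Prod.ext <;>
      simp [rot, rotation_apply, Complex.measurableEquivRealProd_apply,
        Complex.measurableEquivRealProd_symm_apply, Circle.coe_exp, Complex.exp_ofReal_mul_I_re,
        Complex.exp_ofReal_mul_I_im] <;> ring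
  rw [e]
  exact h

theorem rot_mem_disk {θ : ℝ} {p : ℝ × ℝ} : rot θ p ∈ disk ↔ p ∈ disk := by
  have : (p.1 * Real.cos θ - p.2 * Real.sin θ) ^ 2 + (p.1 * Real.sin θ + p.2 * Real.cos θ) ^ 2
      = p.1 ^ 2 + p.2 ^ 2 := by
    linear_combination (p.1 ^ 2 + p.2 ^ 2) * Real.cos_sq_add_sin_sq θ
  simp [disk, rot, this]

theorem prod_mem_disk {t s : ℝ} (ht : t ∈ Set.Icc (-1 : ℝ) 1) :
    (t, s) ∈ disk ↔ s ∈ Set.Icc (-√(1 - t ^ 2)) √(1 - t ^ 2) := by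
  have h : 0 ≤ 1 - t ^ 2 := by nlinarith [ht.1, ht.2]
  rw [Set.mem_Icc, ← abs_le, ← Real.sqrt_sq_eq_abs, Real.sqrt_le_sqrt_iff h]
  simp only [disk, Set.mem_ofPred_eq]
  constructor <;> intro h <;> linarith

theorem mem_Icc_of_mem_disk {t s : ℝ} (h : (t, s) ∈ disk) : t ∈ Set.Icc (-1 : ℝ) 1 := by
  have h' : t ^ 2 + s ^ 2 ≤ 1 := h
  exact abs_le.1 (abs_le_one_iff_mul_self_le_one.2 (by nlinarith [sq_nonneg s]))

section Chords

variable {μ : ℝ} {f : ℝ × ℝ → ℝ}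

theorem integrable_indicator_lineIntegrand (hμ : 0 ≤ μ) (hf : Integrable f (diskMeasure μ))
    (θ : ℝ) :
    Integrable (disk.indicator fun p => lineIntegrand μ f θ p.1 p.2) (volume.prod volume) := by
  rw [integrable_diskMeasure_iff hμ] at hf
  have h1 : IntegrableOn (fun p => f p * weight μ p) disk := by
    refine (hf.const_mul (aConst μ)⁻¹).congr (Filter.Eventually.of_forall fun p => ?_)
    have := (aConst_pos hμ).ne'
    simp only [smul_eq_mul]
    field_simp
  have h2 := (measurePreserving_rot θ).integrable_comp_of_integrable
    (h1.integrable_indicator measurableSet_disk)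
  rw [← Measure.volume_eq_prod]
  refine h2.congr (Filter.Eventually.of_forall fun p => ?_)
  by_cases hp : p ∈ disk
  · rw [Function.comp_apply, Set.indicator_of_mem hp, Set.indicator_of_mem (rot_mem_disk.2 hp)]
    rfl
  · rw [Function.comp_apply, Set.indicator_of_notMem hp,
      Set.indicator_of_notMem (fun h => hp (rot_mem_disk.1 h))]

theorem indicator_disk_eq {t : ℝ} (ht : t ∈ Set.Icc (-1 : ℝ) 1) (g : ℝ × ℝ → ℝ) (s : ℝ) :
    disk.indicator g (t, s) =
      (Set.Icc (-√(1 - t ^ 2)) √(1 - t ^ 2)).indicator (fun s => g (t, s)) s := by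
  by_cases h : (t, s) ∈ disk
  · rw [Set.indicator_of_mem h, Set.indicator_of_mem ((prod_mem_disk ht).1 h)]
  · rw [Set.indicator_of_notMem h,
      Set.indicator_of_notMem (fun h' => h ((prod_mem_disk ht).2 h'))]

theorem integral_indicator_lineIntegrand (μ : ℝ) (f : ℝ × ℝ → ℝ) (θ t : ℝ) :
    ∫ s, disk.indicator (fun p => lineIntegrand μ f θ p.1 p.2) (t, s) =
      (Set.Icc (-1 : ℝ) 1).indicator (radon μ f θ) t := by
  by_cases ht : t ∈ Set.Icc (-1 : ℝ) 1
  · rw [Set.indicator_of_mem ht, radon, intervalIntegral.integral_of_le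
      (by linarith [Real.sqrt_nonneg (1 - t ^ 2)]), ← integral_Icc_eq_integral_Ioc,
      ← integral_indicator measurableSet_Icc]
    refine integral_congr_ae (Filter.Eventually.of_forall fun s => ?_)
    exact indicator_disk_eq ht _ s
  · rw [Set.indicator_of_notMem ht]
    refine integral_eq_zero_of_ae (Filter.Eventually.of_forall fun s => ?_)
    exact Set.indicator_of_notMem (fun h => ht (mem_Icc_of_mem_disk h)) _

theorem ae_intervalIntegrable_lineIntegrand (hμ : 0 ≤ μ) (hf : Integrable f (diskMeasure μ))
    (θ : ℝ) : ∀ᵐ t ∂(volume.restrict (Set.Icc (-1 : ℝ) 1)),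
      IntervalIntegrable (lineIntegrand μ f θ t) volume (-√(1 - t ^ 2)) (√(1 - t ^ 2)) := by
  rw [ae_restrict_iff' measurableSet_Icc]
  filter_upwards [(integrable_indicator_lineIntegrand hμ hf θ).prod_right_ae] with t h ht
  rw [intervalIntegrable_iff_integrableOn_Icc_of_le (by linarith [Real.sqrt_nonneg (1 - t ^ 2)]),
    ← integrable_indicator_iff measurableSet_Icc]
  refine h.congr (Filter.Eventually.of_forall fun s => ?_)
  exact indicator_disk_eq ht _ s

theorem intervalIntegrable_radon (hμ : 0 ≤ μ) (hf : Integrable f (diskMeasure μ)) (θ : ℝ) :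
    IntervalIntegrable (radon μ f θ) volume (-1) 1 := by
  rw [intervalIntegrable_iff_integrableOn_Icc_of_le (by norm_num),
    ← integrable_indicator_iff measurableSet_Icc]
  refine (integrable_indicator_lineIntegrand hμ hf θ).integral_prod_left.congr
    (Filter.Eventually.of_forall fun t => ?_)
  exact integral_indicator_lineIntegrand μ f θ t

theorem integral_radon (hμ : 0 ≤ μ) (hf : Integrable f (diskMeasure μ)) (θ : ℝ) :
    aConst μ * ∫ t in (-1 : ℝ)..1, radon μ f θ t = ∫ p, f p ∂(diskMeasure μ) := by
  have h := integral_prod _ (integrable_indicator_lineIntegrand hμ hf θ)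
  simp only [integral_indicator_lineIntegrand] at h
  rw [intervalIntegral.integral_of_le (by norm_num), ← integral_Icc_eq_integral_Ioc,
    ← integral_indicator measurableSet_Icc, ← h, integral_diskMeasure hμ,
    ← integral_indicator measurableSet_disk, ← Measure.volume_eq_prod, ← integral_const_mul]
  have hemb : MeasurableEmbedding (rot θ) := by
    have hm : ∀ θ, Measurable (rot θ) := fun θ => (measurePreserving_rot θ).measurable
    refine MeasurableEquiv.measurableEmbedding
      { toFun := rot θ, invFun := rot (-θ), left_inv := fun p => ?_, right_inv := fun p => ?_,
        measurable_toFun := hm θ, measurable_invFun := hm (-θ) }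
    all_goals
      have := Real.cos_sq_add_sin_sq θ
      apply Prod.ext <;> simp only [rot, Real.cos_neg, Real.sin_neg]
    · linear_combination p.1 * this
    · linear_combination p.2 * this
    · linear_combination p.1 * this
    · linear_combination p.2 * this
  rw [← (measurePreserving_rot θ).integral_comp hemb
    (disk.indicator fun p => (aConst μ * weight μ p) • f p)]
  refine integral_congr_ae (Filter.Eventually.of_forall fun p => ?_)
  by_cases hp : p ∈ disk
  · beta_reduce
    rw [Set.indicator_of_mem hp, Set.indicator_of_mem (rot_mem_disk.2 hp)]
    simp only [lineIntegrand, smul_eq_mul, rot]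
    ring
  · simp only [Set.indicator_of_notMem hp,
      Set.indicator_of_notMem (fun h => hp ((rot_mem_disk (θ := θ)).1 h)), mul_zero]

theorem radon_mul_ridge (μ : ℝ) (f : ℝ × ℝ → ℝ) (g : ℝ → ℝ) (θ t : ℝ) :
    radon μ (fun p => f p * g (p.1 * Real.cos θ + p.2 * Real.sin θ)) θ t = radon μ f θ t * g t := by
  rw [radon, radon, ← intervalIntegral.integral_mul_const]
  congr 1
  funext s
  have : (t * Real.cos θ - s * Real.sin θ) * Real.cos θ +
      (t * Real.sin θ + s * Real.cos θ) * Real.sin θ = t := by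
    linear_combination t * Real.cos_sq_add_sin_sq θ
  simp only [lineIntegrand, this]
  ring

theorem ae_mem_disk (μ : ℝ) : ∀ᵐ p ∂(diskMeasure μ), p ∈ disk :=
  (withDensity_absolutelyContinuous _ _).ae_le (ae_restrict_mem measurableSet_disk)

theorem memLp_of_continuous (hμ : 0 ≤ μ) {F : Type*} [NormedAddCommGroup F]
    [SecondCountableTopologyEither (ℝ × ℝ) F] {g : ℝ × ℝ → F}
    (hg : Continuous g) (q : ENNReal) : MemLp g q (diskMeasure μ) := by
  have := isFiniteMeasure_diskMeasure hμ
  obtain ⟨M, hM⟩ := (isCompact_Icc (a := ((-1 : ℝ), (-1 : ℝ))) (b := (1, 1))).exists_bound_of_continuousOn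
    hg.continuousOn
  refine MemLp.of_bound hg.aestronglyMeasurable M ?_
  filter_upwards [ae_mem_disk μ] with p hp
  have h1 := mem_Icc_of_mem_disk (t := p.1) (s := p.2) hp
  have h2 := mem_Icc_of_mem_disk (t := p.2) (s := p.1)
    (by have : p.1 ^ 2 + p.2 ^ 2 ≤ 1 := hp; change p.2 ^ 2 + p.1 ^ 2 ≤ 1; linarith)
  exact hM p ⟨⟨h1.1, h2.1⟩, ⟨h1.2, h2.2⟩⟩

theorem integrable_mul_of_continuous (hμ : 0 ≤ μ) (hf : MemLp f 2 (diskMeasure μ))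
    {g : ℝ × ℝ → ℝ} (hg : Continuous g) : Integrable (fun p => f p * g p) (diskMeasure μ) :=
  hf.integrable_mul (memLp_of_continuous hμ hg 2)

/-- Integrating the Radon projection in the direction `θ` against `g` amounts to integrating `f`
against the ridge function `g(x cos θ + y sin θ)`. -/
theorem integral_radon_mul (hμ : 0 ≤ μ) (hf : MemLp f 2 (diskMeasure μ)) {g : ℝ → ℝ}
    (hg : Continuous g) (θ : ℝ) :
    aConst μ * ∫ t in (-1 : ℝ)..1, radon μ f θ t * g t =
      ∫ p, f p * g (p.1 * Real.cos θ + p.2 * Real.sin θ) ∂(diskMeasure μ) := by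
  rw [← integral_radon hμ (integrable_mul_of_continuous hμ hf (by fun_prop)) θ]
  simp only [radon_mul_ridge]

theorem intervalIntegrable_radon_mul (hμ : 0 ≤ μ) (hf : MemLp f 2 (diskMeasure μ)) {g : ℝ → ℝ}
    (hg : Continuous g) (θ : ℝ) :
    IntervalIntegrable (fun t => radon μ f θ t * g t) volume (-1) 1 := by
  have := intervalIntegrable_radon hμ (integrable_mul_of_continuous hμ hf
    (g := fun p => g (p.1 * Real.cos θ + p.2 * Real.sin θ)) (by fun_prop)) θ
  rwa [show radon μ _ θ = fun t => radon μ f θ t * g t from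
    funext fun t => radon_mul_ridge μ f g θ t] at this

end Chords

/-! ### Real polynomials and their expression in `z` and `z̄` -/

/-- Rewriting of a real polynomial in `x`, `y` as a polynomial in `z = x + iy` and `w = x - iy`. -/
noncomputable def complexify : MvPolynomial (Fin 2) ℝ →ₐ[ℝ] MvPolynomial (Fin 2) ℂ :=
  aeval ![lineForm 1 1, lineForm (-Complex.I) Complex.I]

theorem complexify_C (r : ℝ) : complexify (C r) = C (r : ℂ) := by
  rw [complexify, aeval_C]; rfl

theorem complexify_X_zero : complexify (X 0) = lineForm 1 1 := by simp [complexify]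

theorem complexify_X_one : complexify (X 1) = lineForm (-Complex.I) Complex.I := by
  simp [complexify]

/-- Evaluation of a polynomial in `z` and `w` at `w = z̄`. -/
noncomputable def evalC (z : ℂ) : MvPolynomial (Fin 2) ℂ →ₐ[ℂ] ℂ := aeval ![z, starRingEnd ℂ z]

theorem evalC_C (z c : ℂ) : evalC z (C c) = c := by simp [evalC]

theorem evalC_mono (z : ℂ) (a b : ℕ) : evalC z (mono a b) = z ^ a * starRingEnd ℂ z ^ b := by
  simp [evalC, mono]

theorem evalC_complexify (P : MvPolynomial (Fin 2) ℝ) (p : ℝ × ℝ) :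
    evalC (toC p) (complexify P) = (polyFun P p : ℂ) := by
  induction P using MvPolynomial.induction_on with
  | C r => rw [complexify_C, evalC_C]; simp [polyFun]
  | add P Q hP hQ => rw [map_add, map_add, hP, hQ]; simp [polyFun]
  | mul_X P i hP =>
    rw [map_mul, map_mul, hP]
    have : evalC (toC p) (complexify (X i)) = ((![p.1, p.2] i : ℝ) : ℂ) := by
      fin_cases i
      · simp only [Fin.zero_eta, complexify_X_zero, lineForm, map_add, map_mul, evalC_C, evalC_mono]
        apply Complex.ext <;> simp [toC]
        ring
      · simp only [Fin.mk_one, complexify_X_one, lineForm, map_add, map_mul, evalC_C, evalC_mono]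
        apply Complex.ext <;> simp [toC] <;> ring
    rw [this]
    simp [polyFun]

theorem complexify_mem_degLT {P : MvPolynomial (Fin 2) ℝ} {k : ℕ} (hP : P.totalDegree ≤ k) :
    complexify P ∈ degLT (k + 1) := by
  rw [P.as_sum, map_sum]
  refine Submodule.sum_mem _ fun s hs => ?_
  have hs' := (le_totalDegree hs).trans hP
  rw [Finsupp.sum_fintype _ _ (fun _ => rfl), Fin.sum_univ_two] at hs'
  rw [monomial_eq, Finsupp.prod_fintype _ _ (fun i => pow_zero _), Fin.prod_univ_two, map_mul,
    complexify_C, map_mul, map_pow, map_pow, complexify_X_zero, complexify_X_one]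
  exact C_mul_mem_degLT _ (mul_mem_degLT (lineForm_pow_mem _ _ _) (lineForm_pow_mem _ _ _)
    (by omega))

theorem mono_one_zero : mono 1 0 = complexify (X 0) + C Complex.I * complexify (X 1) := by
  rw [complexify_X_zero, complexify_X_one, lineForm, lineForm, mul_add, ← mul_assoc, ← mul_assoc,
    ← C_mul, ← C_mul]
  have h1 : Complex.I * (-Complex.I / 2) = 1 / 2 := by
    linear_combination (-(1 / 2) : ℂ) * Complex.I_mul_I
  have h2 : Complex.I * (Complex.I / 2) = -(1 / 2) := by
    linear_combination (1 / 2 : ℂ) * Complex.I_mul_I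
  rw [h1, h2]
  have h3 : (C (1 / 2 : ℂ) + C (1 / 2) : MvPolynomial (Fin 2) ℂ) = 1 := by
    rw [← C_add, ← C_1]; norm_num
  rw [C_neg]
  linear_combination (-mono 1 0) * h3

theorem mono_zero_one : mono 0 1 = complexify (X 0) - C Complex.I * complexify (X 1) := by
  rw [complexify_X_zero, complexify_X_one, lineForm, lineForm, mul_add, ← mul_assoc, ← mul_assoc,
    ← C_mul, ← C_mul]
  have h1 : Complex.I * (-Complex.I / 2) = 1 / 2 := by
    linear_combination (-(1 / 2) : ℂ) * Complex.I_mul_I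
  have h2 : Complex.I * (Complex.I / 2) = -(1 / 2) := by
    linear_combination (1 / 2 : ℂ) * Complex.I_mul_I
  rw [h1, h2]
  have h3 : (C (1 / 2 : ℂ) + C (1 / 2) : MvPolynomial (Fin 2) ℂ) = 1 := by
    rw [← C_add, ← C_1]; norm_num
  rw [C_neg]
  linear_combination (-mono 0 1) * h3

/-- A monomial in `z`, `w` splits into real and imaginary parts of the same degree. -/
theorem exists_mono_eq_complexify (a b : ℕ) : ∃ U V : MvPolynomial (Fin 2) ℝ,
    U.totalDegree ≤ a + b ∧ V.totalDegree ≤ a + b ∧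
      mono a b = complexify U + C Complex.I * complexify V := by
  have hI : (C Complex.I : MvPolynomial (Fin 2) ℂ) * C Complex.I = -1 := by
    rw [← C_mul, Complex.I_mul_I]; simp
  have hdeg : ∀ (i : Fin 2) {W : MvPolynomial (Fin 2) ℝ} {m : ℕ}, W.totalDegree ≤ m →
      (W * X i).totalDegree ≤ m + 1 := fun i W m h =>
    (totalDegree_mul _ _).trans (add_le_add h (totalDegree_X i).le)
  induction a with
  | zero =>
    induction b with
    | zero => exact ⟨1, 0, by simp, by simp, by simp [mono_zero]⟩
    | succ b ih =>
      obtain ⟨U, V, hU, hV, h⟩ := ih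
      refine ⟨U * X 0 + V * X 1, V * X 0 - U * X 1,
        (totalDegree_add _ _).trans (max_le (hdeg 0 hU) (hdeg 1 hV)),
        (totalDegree_sub _ _).trans (max_le (hdeg 0 hV) (hdeg 1 hU)), ?_⟩
      rw [show mono 0 (b + 1) = mono 0 b * mono 0 1 by rw [mono_mul], h, mono_zero_one]
      simp only [map_add, map_sub, map_mul]
      linear_combination (-complexify V * complexify (X 1)) * hI
  | succ a ih =>
    obtain ⟨U, V, hU, hV, h⟩ := ih
    rw [show a + 1 + b = a + b + 1 by ring]
    refine ⟨U * X 0 - V * X 1, V * X 0 + U * X 1,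
      (totalDegree_sub _ _).trans (max_le (hdeg 0 hU) (hdeg 1 hV)),
      (totalDegree_add _ _).trans (max_le (hdeg 0 hV) (hdeg 1 hU)), ?_⟩
    rw [show mono (a + 1) b = mono a b * mono 1 0 by rw [mono_mul]; rfl, h, mono_one_zero]
    simp only [map_add, map_sub, map_mul]
    linear_combination (complexify V * complexify (X 1)) * hI

theorem continuous_evalC (q : MvPolynomial (Fin 2) ℂ) :
    Continuous fun p : ℝ × ℝ => evalC (toC p) q := by
  have hC : Continuous toC := by
    have : toC = fun p : ℝ × ℝ => (p.1 : ℂ) + p.2 * Complex.I := by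
      funext p; apply Complex.ext <;> simp [toC]
    rw [this]; fun_prop
  induction q using MvPolynomial.induction_on with
  | C c => simpa [evalC_C] using continuous_const
  | add P Q hP hQ => simp only [map_add]; exact hP.add hQ
  | mul_X P i hP =>
    simp only [map_mul]
    refine hP.mul ?_
    fin_cases i
    · simpa [evalC] using hC
    · simpa [evalC, Function.comp_def] using Complex.continuous_conj.comp hC

theorem continuous_polyFun (P : MvPolynomial (Fin 2) ℝ) : Continuous (polyFun P) := by
  have h := Complex.continuous_re.comp (continuous_evalC (complexify P))
  simpa [Function.comp_def, evalC_complexify] using h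

/-- Integration over the disk as a functional on polynomials in `z` and `z̄`. -/
noncomputable def diskE {μ : ℝ} (hμ : 0 ≤ μ) : MvPolynomial (Fin 2) ℂ →ₗ[ℂ] ℂ where
  toFun q := ∫ p, evalC (toC p) q ∂(diskMeasure μ)
  map_add' q r := by
    simp only [map_add]
    exact integral_add
      (memLp_one_iff_integrable.1 (memLp_of_continuous hμ (continuous_evalC q) 1))
      (memLp_one_iff_integrable.1 (memLp_of_continuous hμ (continuous_evalC r) 1))
  map_smul' c q := by
    simp only [map_smul, smul_eq_mul, RingHom.id_apply]
    exact integral_const_mul _ _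

theorem isDiskMoment_diskE {μ : ℝ} (hμ : 0 ≤ μ) : IsDiskMoment (μ + 1 / 2) (diskE hμ) := by
  intro a b
  rw [← integral_monomial_diskMeasure hμ]
  simp only [diskE, LinearMap.coe_mk, AddHom.coe_mk, evalC_mono]

theorem diskE_complexify_mul {μ : ℝ} (hμ : 0 ≤ μ) (P Q : MvPolynomial (Fin 2) ℝ) :
    diskE hμ (complexify P * complexify Q) =
      ((∫ p, polyFun P p * polyFun Q p ∂(diskMeasure μ) : ℝ) : ℂ) := by
  rw [← integral_complex_ofReal]
  simp only [diskE, LinearMap.coe_mk, AddHom.coe_mk, map_mul, evalC_complexify, Complex.ofReal_mul]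

/-! ### The orthogonal polynomial spaces -/

section Spaces

variable {μ : ℝ}

/-- The class of a real polynomial in `L²`. -/
noncomputable def polyLp (hμ : 0 ≤ μ) (P : MvPolynomial (Fin 2) ℝ) : DiskL2 μ :=
  (memLp_of_continuous hμ (continuous_polyFun P) 2).toLp

theorem coeFn_polyLp (hμ : 0 ≤ μ) (P : MvPolynomial (Fin 2) ℝ) :
    polyLp hμ P =ᵐ[diskMeasure μ] polyFun P := MemLp.coeFn_toLp _

theorem polyLp_mem (hμ : 0 ≤ μ) {P : MvPolynomial (Fin 2) ℝ} {k : ℕ} (h : P.totalDegree ≤ k) :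
    polyLp hμ P ∈ polySpace μ k :=
  ⟨P, (mem_restrictTotalDegree _ _ _).2 h, MemLp.coeFn_toLp _⟩

theorem inner_eq_integral {g h : DiskL2 μ} {u v : ℝ × ℝ → ℝ} (hg : g =ᵐ[diskMeasure μ] u)
    (hh : h =ᵐ[diskMeasure μ] v) : inner ℝ g h = ∫ p, u p * v p ∂(diskMeasure μ) := by
  rw [L2.inner_def]
  refine integral_congr_ae ?_
  filter_upwards [hg, hh] with p h1 h2
  rw [h1, h2]
  simp [mul_comm]

theorem polyLp_mem_orthPolySpace (hμ : 0 ≤ μ) {Q : MvPolynomial (Fin 2) ℝ} {k : ℕ}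
    (hQ : Q.totalDegree ≤ k) (h : ∀ q ∈ degLT k, diskE hμ (complexify Q * q) = 0) :
    polyLp hμ Q ∈ orthPolySpace μ k := by
  refine ⟨polyLp_mem hμ hQ, ?_⟩
  simp only [SetLike.mem_coe, Submodule.mem_iInf, Submodule.mem_orthogonal']
  rintro j g ⟨P, hP, hg⟩
  rw [inner_eq_integral (coeFn_polyLp hμ Q) hg]
  have h1 := h _ (degLT_mono (show (j : ℕ) + 1 ≤ k from j.2)
    (complexify_mem_degLT ((mem_restrictTotalDegree _ _ _).1 hP)))
  rw [diskE_complexify_mul] at h1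
  exact_mod_cast h1

theorem diskE_eq_zero_of_mem_orthPolySpace (hμ : 0 ≤ μ) {g : DiskL2 μ} {k : ℕ}
    (hg : g ∈ orthPolySpace μ k) {P : MvPolynomial (Fin 2) ℝ} (hP : g =ᵐ[diskMeasure μ] polyFun P)
    {q : MvPolynomial (Fin 2) ℂ} (hq : q ∈ degLT k) : diskE hμ (complexify P * q) = 0 := by
  have h0 : ∀ a b, a + b < k → ∀ U : MvPolynomial (Fin 2) ℝ, U.totalDegree ≤ a + b →
      diskE hμ (complexify P * complexify U) = 0 := by
    intro a b hab U hU
    have h1 := hg.2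
    simp only [SetLike.mem_coe, Submodule.mem_iInf, Submodule.mem_orthogonal'] at h1
    have h2 := h1 ⟨a + b, hab⟩ _ (polyLp_mem hμ hU)
    rw [inner_eq_integral hP (coeFn_polyLp hμ U)] at h2
    rw [diskE_complexify_mul, h2, Complex.ofReal_zero]
  refine eq_zero_of_mem_degLT (L := diskE hμ ∘ₗ LinearMap.mulLeft ℂ _) ?_ hq
  intro a b hab
  obtain ⟨U, V, hU, hV, h⟩ := exists_mono_eq_complexify a b
  simp only [LinearMap.comp_apply, LinearMap.mulLeft_apply]
  rw [h, mul_add, map_add, h0 a b hab U hU, mul_left_comm, E_C_mul, h0 a b hab V hV]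
  simp

/-- The real ridge polynomial `C_k^{μ+1/2}(x cos ξ + y sin ξ)`. -/
noncomputable def realRidge (μ : ℝ) (k : ℕ) (ξ : ℝ) : MvPolynomial (Fin 2) ℝ :=
  Polynomial.aeval (C (Real.cos ξ) * X 0 + C (Real.sin ξ) * X 1) (gegenbauer (μ + 1 / 2) k)

theorem polyFun_realRidge (μ : ℝ) (k : ℕ) (ξ : ℝ) (p : ℝ × ℝ) :
    polyFun (realRidge μ k ξ) p =
      (gegenbauer (μ + 1 / 2) k).eval (p.1 * Real.cos ξ + p.2 * Real.sin ξ) := by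
  have h := Polynomial.aeval_algHom_apply (aeval ![p.1, p.2] : MvPolynomial (Fin 2) ℝ →ₐ[ℝ] ℝ)
    (C (Real.cos ξ) * X 0 + C (Real.sin ξ) * X 1) (gegenbauer (μ + 1 / 2) k)
  rw [polyFun, realRidge, ← coe_aeval_eq_eval]
  refine h.symm.trans ?_
  simp [Polynomial.coe_aeval_eq_eval, mul_comm]

theorem complexify_realRidge (μ : ℝ) (k : ℕ) (ξ : ℝ) :
    complexify (realRidge μ k ξ) =
      ridge (μ + 1 / 2) (Complex.exp (-(ξ * Complex.I))) (Complex.exp (ξ * Complex.I)) k := by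
  rw [realRidge, ← Polynomial.aeval_algHom_apply, ridge]
  congr 2
  rw [map_add, map_mul, map_mul, complexify_C, complexify_C, complexify_X_zero, complexify_X_one]
  simp only [lineForm, mul_add, ← mul_assoc, ← C_mul]
  rw [← neg_mul, Complex.exp_mul_I, Complex.exp_mul_I, Complex.cos_neg, Complex.sin_neg,
    Complex.ofReal_cos, Complex.ofReal_sin]
  have e1 : (Complex.cos ξ + -Complex.sin ξ * Complex.I) / 2 =
    Complex.cos ξ * (1 / 2) + Complex.sin ξ * (-Complex.I / 2) := by ring
  have e2 : (Complex.cos ξ + Complex.sin ξ * Complex.I) / 2 =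
    Complex.cos ξ * (1 / 2) + Complex.sin ξ * (Complex.I / 2) := by ring
  rw [e1, e2, C_add, C_add]
  ring

theorem totalDegree_realRidge (μ : ℝ) (k : ℕ) (ξ : ℝ) : (realRidge μ k ξ).totalDegree ≤ k := by
  have hlin : (C (Real.cos ξ) * X 0 + C (Real.sin ξ) * X 1 :
      MvPolynomial (Fin 2) ℝ).totalDegree ≤ 1 := by
    refine (totalDegree_add _ _).trans (max_le ?_ ?_) <;>
      exact (totalDegree_mul _ _).trans (by simp)
  have hC : ∀ (c : ℝ) {W : MvPolynomial (Fin 2) ℝ} {m : ℕ}, W.totalDegree ≤ m →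
      (C c * W).totalDegree ≤ m := fun c W m h =>
    (totalDegree_mul _ _).trans (by simpa using h)
  induction k using Nat.twoStepInduction with
  | zero => simp [realRidge, gegenbauer]
  | one =>
    rw [realRidge, gegenbauer, map_mul, Polynomial.aeval_C, Polynomial.aeval_X]
    exact hC _ hlin
  | more k ih0 ih1 =>
    rw [realRidge, gegenbauer, map_sub, map_mul, map_mul, map_mul, Polynomial.aeval_C,
      Polynomial.aeval_C, Polynomial.aeval_X, mul_assoc]
    refine (totalDegree_sub _ _).trans (max_le (hC _ ?_) (hC _ (ih0.trans (by omega))))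
    exact (totalDegree_mul _ _).trans ((add_le_add hlin ih1).trans (by omega))

theorem polyLp_realRidge_mem (hμ : 0 ≤ μ) (k : ℕ) (ξ : ℝ) :
    polyLp hμ (realRidge μ k ξ) ∈ orthPolySpace μ k := by
  refine polyLp_mem_orthPolySpace hμ (totalDegree_realRidge μ k ξ) fun q hq => ?_
  rw [complexify_realRidge]
  exact (isDiskMoment_diskE hμ).ridge_mul_of_mem_degLT (by positivity)
    (by rw [← Complex.exp_add]; simp) k q hq

/-- Ridge polynomials do not distinguish `f` from its projection. -/
theorem integral_mul_realRidge (hμ : 0 ≤ μ) {f : ℝ × ℝ → ℝ} (hf : MemLp f 2 (diskMeasure μ))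
    {k : ℕ} {P : MvPolynomial (Fin 2) ℝ}
    (hP : diskProj μ k (hf.toLp f) =ᵐ[diskMeasure μ] polyFun P) (ξ : ℝ) :
    ∫ p, f p * polyFun (realRidge μ k ξ) p ∂(diskMeasure μ) =
      ∫ p, polyFun P p * polyFun (realRidge μ k ξ) p ∂(diskMeasure μ) := by
  rw [← inner_eq_integral (MemLp.coeFn_toLp hf) (coeFn_polyLp hμ (realRidge μ k ξ)),
    ← inner_eq_integral hP (coeFn_polyLp hμ (realRidge μ k ξ)), ← sub_eq_zero,
    ← inner_sub_left]
  exact Submodule.starProjection_inner_eq_zero _ _ (polyLp_realRidge_mem hμ k ξ)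

theorem exists_polyFun_diskProj (μ : ℝ) (k : ℕ) (g : DiskL2 μ) :
    ∃ P : MvPolynomial (Fin 2) ℝ, P.totalDegree ≤ k ∧ diskProj μ k g =ᵐ[diskMeasure μ] polyFun P := by
  obtain ⟨P, hP, h⟩ := (Submodule.starProjection_apply_mem (orthPolySpace μ k) g).1
  exact ⟨P, (mem_restrictTotalDegree _ _ _).1 hP, h⟩

/-- The polynomial representing `proj_k f` is a combination of disk polynomials of degree `k`, and
the pairings of `f` with ridge polynomials are its values on the unit circle. -/
theorem exists_zernike_expansion (hμ : 0 ≤ μ) {f : ℝ × ℝ → ℝ} (hf : MemLp f 2 (diskMeasure μ))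
    {k : ℕ} {P : MvPolynomial (Fin 2) ℝ} (hdeg : P.totalDegree ≤ k)
    (hP : diskProj μ k (hf.toLp f) =ᵐ[diskMeasure μ] polyFun P) :
    ∃ d : ℕ → ℂ,
      (∀ p, (polyFun P p : ℂ) = ∑ a ∈ Finset.range (k + 1),
        d a * evalC (toC p) (zernike (μ + 1 / 2) a (k - a))) ∧
      ∀ ξ : ℝ, (((k + μ + 1 / 2) / (μ + 1 / 2) *
          ∫ p, f p * polyFun (realRidge μ k ξ) p ∂(diskMeasure μ) : ℝ) : ℂ) =
        ∑ a ∈ Finset.range (k + 1), d a *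
          (Complex.exp (ξ * Complex.I) ^ a * Complex.exp (-(ξ * Complex.I)) ^ (k - a)) := by
  have hE := isDiskMoment_diskE hμ
  have hlam : 0 < μ + 1 / 2 := by positivity
  obtain ⟨d, hd⟩ := hE.exists_eq_sum_zernike hlam (complexify_mem_degLT hdeg) fun q hq =>
    diskE_eq_zero_of_mem_orthPolySpace hμ (Submodule.starProjection_apply_mem _ _) hP hq
  refine ⟨d, fun p => ?_, fun ξ => ?_⟩
  · rw [← evalC_complexify, hd, map_sum]
    simp only [map_mul, evalC_C]
  · rw [integral_mul_realRidge hμ hf hP, Complex.ofReal_mul, ← diskE_complexify_mul hμ,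
      complexify_realRidge, hd, Finset.sum_mul, map_sum, Finset.mul_sum]
    refine Finset.sum_congr rfl fun a ha => ?_
    rw [mul_assoc, E_C_mul, mul_comm (zernike _ _ _), hE.ridge_mul_zernike hlam
      (show a + (k - a) = k by have := Finset.mem_range.1 ha; omega), mul_left_comm, ← mul_assoc
      ((_ : ℝ) : ℂ) ((_ : ℝ) : ℂ), ← Complex.ofReal_mul]
    have : (k + μ + 1 / 2) / (μ + 1 / 2) * ((μ + 1 / 2) / (k + (μ + 1 / 2))) = 1 := by
      have : (k : ℝ) + (μ + 1 / 2) ≠ 0 := by positivity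
      field_simp
      ring
    rw [this, Complex.ofReal_one, one_mul]

end Spaces

/-! ### Jacobi polynomials and the polar basis -/

/-- Expansion of Bernstein-type sums in powers of `v`; the coefficients are the binomial transform
of `c`. -/
theorem sum_choose_mul_one_sub_pow (l : ℕ) (c : ℕ → ℝ) (v : ℝ) :
    ∑ j ∈ Finset.range (l + 1), (l.choose j : ℝ) * ((-1) ^ j * c j * v ^ j * (1 - v) ^ (l - j)) =
      ∑ i ∈ Finset.range (l + 1), (l.choose i : ℝ) *
        ((-1) ^ i * (∑ j ∈ Finset.range (i + 1), (i.choose j : ℝ) * c j) * v ^ i) := by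
  induction l generalizing c with
  | zero => simp
  | succ l ih =>
    rw [Finset.sum_choose_succ_mul (fun j r => (-1) ^ j * c j * v ^ j * (1 - v) ^ r) l,
      Finset.sum_choose_succ_mul (fun i _ => (-1) ^ i *
        (∑ j ∈ Finset.range (i + 1), (i.choose j : ℝ) * c j) * v ^ i) l]
    have h1 := ih c
    have h2 := ih fun j => c (j + 1)
    have e1 : ∑ j ∈ Finset.range (l + 1), (l.choose j : ℝ) *
        ((-1) ^ j * c j * v ^ j * (1 - v) ^ (l + 1 - j)) = (1 - v) *
        ∑ j ∈ Finset.range (l + 1), (l.choose j : ℝ) *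
          ((-1) ^ j * c j * v ^ j * (1 - v) ^ (l - j)) := by
      rw [Finset.mul_sum]
      refine Finset.sum_congr rfl fun j hj => ?_
      rw [Nat.succ_sub (Nat.lt_succ_iff.1 (Finset.mem_range.1 hj)), pow_succ]
      ring
    have e2 : ∑ j ∈ Finset.range (l + 1), (l.choose j : ℝ) *
        ((-1) ^ (j + 1) * c (j + 1) * v ^ (j + 1) * (1 - v) ^ (l - j)) = -v *
        ∑ j ∈ Finset.range (l + 1), (l.choose j : ℝ) *
          ((-1) ^ j * c (j + 1) * v ^ j * (1 - v) ^ (l - j)) := by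
      rw [Finset.mul_sum]
      exact Finset.sum_congr rfl fun j _ => by ring
    have e3 : ∑ i ∈ Finset.range (l + 1), (l.choose i : ℝ) * ((-1) ^ (i + 1) *
        (∑ j ∈ Finset.range (i + 1 + 1), ((i + 1).choose j : ℝ) * c j) * v ^ (i + 1)) =
        -v * (∑ i ∈ Finset.range (l + 1), (l.choose i : ℝ) *
          ((-1) ^ i * (∑ j ∈ Finset.range (i + 1), (i.choose j : ℝ) * c j) * v ^ i) +
        ∑ i ∈ Finset.range (l + 1), (l.choose i : ℝ) *
          ((-1) ^ i * (∑ j ∈ Finset.range (i + 1), (i.choose j : ℝ) * c (j + 1)) * v ^ i)) := by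
      rw [← Finset.sum_add_distrib, Finset.mul_sum]
      refine Finset.sum_congr rfl fun i _ => ?_
      rw [Finset.sum_choose_succ_mul (fun j _ => c j) i]
      ring
    rw [e1, e2, e3, h1, h2]
    ring

/-- The radial factor of the disk polynomial of bidegree `(l, l + m)` as a function of `r²`,
equal to `1` at `r = 1`. -/
noncomputable def zernikeRadial (lam : ℝ) (l m : ℕ) (ρ : ℝ) : ℝ :=
  ∑ i ∈ Finset.range (l + 1), (l.choose i : ℝ) *
    ((-1) ^ i * (risingFac (lam + (l + m : ℕ)) i / risingFac lam i) * (1 - ρ) ^ i)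

theorem zernikeRadial_one (lam : ℝ) (l m : ℕ) : zernikeRadial lam l m 1 = 1 := by
  rw [zernikeRadial, Finset.sum_eq_single 0 (fun i _ hi => by simp [hi]) (by simp)]
  simp [risingFac_zero]

/-- Pfaff's transformation: the symmetric form of the disk polynomial, in powers of `1 - |z|²` and
`|z|²`, agrees with the hypergeometric form in powers of `1 - |z|²` alone. -/
theorem evalC_zernike {lam : ℝ} (hlam : 0 < lam) (l m : ℕ) (z : ℂ) :
    evalC z (zernike lam l (l + m)) =
      starRingEnd ℂ z ^ m * (zernikeRadial lam l m (Complex.normSq z) : ℂ) := by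
  have e : zernikeRadial lam l m (Complex.normSq z) = ∑ j ∈ Finset.range (l + 1),
      (l.choose j : ℝ) * ((-1) ^ j * ((l + m).descFactorial j / risingFac lam j) *
        (1 - Complex.normSq z) ^ j * (Complex.normSq z) ^ (l - j)) := by
    have h := sum_choose_mul_one_sub_pow l (fun j => (l + m).descFactorial j / risingFac lam j)
      (1 - Complex.normSq z)
    rw [sub_sub_cancel] at h
    rw [h, zernikeRadial]
    simp only [sum_choose_descFactorial_div hlam]
  rw [e, Complex.ofReal_sum, zernike, map_sum, Finset.mul_sum]
  refine Finset.sum_congr rfl fun j hj => ?_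
  have hj' := Nat.lt_succ_iff.1 (Finset.mem_range.1 hj)
  rw [map_mul, map_mul, map_pow, map_sub, map_one, evalC_C, evalC_mono, evalC_mono,
    show l + m - j = (l - j) + m by omega, zernikeCoeff]
  push_cast
  rw [Complex.normSq_eq_conj_mul_self, mul_pow, pow_add]
  ring

theorem zernikeCoeff_comm (lam : ℝ) (a b j : ℕ) : zernikeCoeff lam a b j = zernikeCoeff lam b a j := by
  have h : (a.choose j : ℝ) * b.descFactorial j = b.choose j * a.descFactorial j := by
    rw [Nat.descFactorial_eq_factorial_mul_choose, Nat.descFactorial_eq_factorial_mul_choose]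
    push_cast; ring
  rw [zernikeCoeff, zernikeCoeff, ← mul_div_assoc, h, mul_div_assoc]

theorem evalC_zernike_conj (lam : ℝ) (a b : ℕ) (z : ℂ) :
    evalC z (zernike lam b a) = starRingEnd ℂ (evalC z (zernike lam a b)) := by
  have h : ∀ a b : ℕ, evalC z (zernike lam a b) = ∑ j ∈ Finset.range (a + b + 1),
      (zernikeCoeff lam a b j : ℂ) * ((1 - z * starRingEnd ℂ z) ^ j *
        (z ^ (a - j) * starRingEnd ℂ z ^ (b - j))) := by
    intro a b
    rw [zernike, map_sum]
    have : ∀ j, evalC z (C (zernikeCoeff lam a b j : ℂ) * ((1 - mono 1 1) ^ j *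
        mono (a - j) (b - j))) = (zernikeCoeff lam a b j : ℂ) * ((1 - z * starRingEnd ℂ z) ^ j *
        (z ^ (a - j) * starRingEnd ℂ z ^ (b - j))) := by
      intro j
      simp [evalC_mono]
    simp only [this]
    refine Finset.sum_subset (Finset.range_mono (by omega)) fun j _ hj => ?_
    rw [zernikeCoeff, Nat.choose_eq_zero_of_lt (by simpa using hj)]
    simp
  rw [h, h, map_sum, add_comm b a]
  refine Finset.sum_congr rfl fun j _ => ?_
  simp only [map_mul, map_pow, map_sub, map_one, Complex.conj_conj, Complex.conj_ofReal,
    zernikeCoeff_comm lam b a j]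
  ring

theorem risingFac_neg_natCast (n j : ℕ) :
    risingFac (-(n : ℝ)) j = (-1) ^ j * (j.factorial * n.choose j) := by
  have h : (n.descFactorial j : ℝ) = j.factorial * n.choose j := by
    exact_mod_cast Nat.descFactorial_eq_factorial_mul_choose n j
  rw [← h]
  induction j with
  | zero => simp [risingFac_zero]
  | succ j ih =>
    rw [risingFac_succ, ih (by exact_mod_cast Nat.descFactorial_eq_factorial_mul_choose n j),
      cast_descFactorial_succ]
    ring

section Jacobi

variable {μ : ℝ}

theorem jacobi_one (α β : ℝ) (l : ℕ) :
    jacobi α β l 1 = risingFac (α + 1) l / (l.factorial : ℝ) := by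
  rw [jacobi, Finset.sum_eq_single 0 (fun j _ hj => by simp [hj]) (by simp)]
  simp [risingFac_zero]

/-- With `r² = ρ`, the Jacobi polynomial of the polar basis is its value at `1` times the radial
factor of a disk polynomial. -/
theorem jacobi_eq (μ : ℝ) (l m : ℕ) (ρ : ℝ) :
    jacobi (μ - 1 / 2) m l (2 * ρ - 1) =
      jacobi (μ - 1 / 2) m l 1 * zernikeRadial (μ + 1 / 2) l m ρ := by
  rw [jacobi_one, jacobi, zernikeRadial]
  congr 1
  refine Finset.sum_congr rfl fun j _ => ?_
  have hj : (j.factorial : ℝ) ≠ 0 := by positivity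
  rw [risingFac_neg_natCast, show μ - 1 / 2 + 1 = μ + 1 / 2 by ring,
    show (l : ℝ) + (μ - 1 / 2) + m + 1 = μ + 1 / 2 + (l + m : ℕ) by push_cast; ring,
    show (1 - (2 * ρ - 1)) / 2 = 1 - ρ by ring]
  field_simp

theorem continuous_jacobi (α β : ℝ) (l : ℕ) : Continuous (jacobi α β l) := by
  unfold jacobi; fun_prop

theorem jacobi_one_pos (hμ : 0 ≤ μ) (β : ℝ) (l : ℕ) : 0 < jacobi (μ - 1 / 2) β l 1 := by
  rw [jacobi_one]
  exact div_pos (risingFac_pos (by linarith) l) (by positivity)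

theorem integral_sq_mul_jacobiWeight_pos {α β : ℝ} (hα : -1 < α) (hβ : 0 ≤ β) {g : ℝ → ℝ}
    (hg : Continuous g) (h1 : g 1 ≠ 0) :
    0 < ∫ t in (-1 : ℝ)..1, g t ^ 2 * jacobiWeight α β t := by
  have hint : IntervalIntegrable (fun t => g t ^ 2 * jacobiWeight α β t) volume (-1) 1 := by
    have h2 : IntervalIntegrable (fun t : ℝ => (1 - t) ^ α) volume (-1) 1 := by
      have := (intervalIntegral.intervalIntegrable_rpow' (a := 2) (b := 0) hα).comp_sub_left 1
      norm_num at this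
      exact this
    have h3 : Continuous fun t : ℝ => g t ^ 2 * (1 + t) ^ β :=
      (hg.pow 2).mul (Continuous.rpow_const (by fun_prop) fun _ => Or.inr hβ)
    refine (h2.continuousOn_mul h3.continuousOn).congr fun t _ => ?_
    simp only [jacobiWeight]
    ring
  have hpos : ∀ t ∈ Set.Ioo (-1 : ℝ) 1, 0 < jacobiWeight α β t := fun t ht =>
    mul_pos (Real.rpow_pos_of_pos (by linarith [ht.2]) _)
      (Real.rpow_pos_of_pos (by linarith [ht.1]) _)
  have hnn : 0 ≤ᵐ[volume.restrict (Set.Ioc (-1 : ℝ) 1)] fun t => g t ^ 2 * jacobiWeight α β t := by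
    rw [Filter.EventuallyLE, ae_restrict_iff' measurableSet_Ioc]
    refine Filter.Eventually.of_forall fun t ht => ?_
    exact mul_nonneg (sq_nonneg _) (mul_nonneg (Real.rpow_nonneg (by linarith [ht.2]) _)
      (Real.rpow_nonneg (by linarith [ht.1]) _))
  rw [intervalIntegral.integral_pos_iff_support_of_nonneg_ae' (by
    rwa [Set.uIoc_of_le (by norm_num : (-1 : ℝ) ≤ 1)]) hint]
  refine ⟨by norm_num, ?_⟩
  -- `g` does not vanish near `1`, so the integrand is positive on a nonempty open set
  obtain ⟨ε, hε, hball⟩ := Metric.isOpen_iff.1 (isOpen_ne_fun hg continuous_const (g := fun _ => 0))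
    1 h1
  have hsub : Set.Ioo (max (-1) (1 - ε)) 1 ⊆
      Function.support (fun t => g t ^ 2 * jacobiWeight α β t) ∩ Set.Ioc (-1) 1 := by
    intro t ht
    have ht1 : -1 < t := (le_max_left _ _).trans_lt ht.1
    have ht2 : 1 - ε < t := (le_max_right _ _).trans_lt ht.1
    have hgt : g t ≠ 0 := hball (by
      rw [Metric.mem_ball, Real.dist_eq, abs_lt]; constructor <;> linarith [ht.2])
    exact ⟨mul_ne_zero (pow_ne_zero 2 hgt) (hpos t ⟨ht1, ht.2⟩).ne', ht1, ht.2.le⟩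
  refine lt_of_lt_of_le ?_ (measure_mono hsub)
  rw [Real.volume_Ioo, ENNReal.ofReal_pos, sub_pos, max_lt_iff]
  constructor <;> linarith

/-- The norm is a nonzero number, so that dividing by its square root in `orthoJacobi` is
meaningful and cancels in `dSum`. -/
theorem jacobiNormSq_pos (hμ : 0 ≤ μ) (l m : ℕ) : 0 < jacobiNormSq (μ - 1 / 2) m l := by
  refine mul_pos (inv_pos.2 ?_) ?_
  · simpa using integral_sq_mul_jacobiWeight_pos (α := μ - 1 / 2) (β := m) (by linarith)
      (by positivity) (g := fun _ => 1) continuous_const one_ne_zero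
  · exact integral_sq_mul_jacobiWeight_pos (by linarith) (by positivity)
      (continuous_jacobi _ _ _) (jacobi_one_pos hμ _ _).ne'

theorem hConst_pos (hμ : 0 ≤ μ) (l k : ℕ) : 0 < hConst μ l k := by
  refine Real.sqrt_pos.2 (div_pos (Real.Gamma_pos_of_pos (by positivity))
    (mul_pos (Real.Gamma_pos_of_pos (by positivity)) (Real.Gamma_pos_of_pos (by positivity))))

theorem bigHConst_pos (hμ : 0 ≤ μ) (l k : ℕ) : 0 < bigHConst μ l k :=
  mul_pos (hConst_pos hμ l k) (div_pos (jacobi_one_pos hμ _ _)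
    (Real.sqrt_pos.2 (jacobiNormSq_pos hμ _ _)))

theorem radialPart_eq (μ : ℝ) (l k : ℕ) (r : ℝ) : radialPart μ l k r =
    (if 2 * l < k then √2 else 1) * bigHConst μ l k *
      zernikeRadial (μ + 1 / 2) l (k - 2 * l) (r ^ 2) * r ^ (k - 2 * l) := by
  rw [radialPart, bigHConst, orthoJacobi, orthoJacobi, jacobi_eq]
  ring

theorem norm_pow_mul_cos_add_sin (z : ℂ) (m : ℕ) :
    ‖z‖ ^ m * Real.cos (m * z.arg) = (z ^ m).re ∧ ‖z‖ ^ m * Real.sin (m * z.arg) = (z ^ m).im := by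
  have h : z ^ m = ((‖z‖ ^ m : ℝ) : ℂ) * Complex.exp (((m * z.arg : ℝ) : ℂ) * Complex.I) := by
    conv_lhs => rw [← Complex.norm_mul_exp_arg_mul_I z]
    rw [mul_pow, ← Complex.exp_nat_mul]
    push_cast
    congr 2
    ring
  rw [h, Complex.re_ofReal_mul, Complex.im_ofReal_mul, Complex.exp_ofReal_mul_I_re,
    Complex.exp_ofReal_mul_I_im]
  exact ⟨rfl, rfl⟩

theorem basisCos_eq (μ : ℝ) (l k : ℕ) (x y : ℝ) : basisCos μ l k x y =
    (if 2 * l < k then √2 else 1) * bigHConst μ l k *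
      zernikeRadial (μ + 1 / 2) l (k - 2 * l) (Complex.normSq ⟨x, y⟩) *
        ((⟨x, y⟩ : ℂ) ^ (k - 2 * l)).re := by
  rw [basisCos, radialPart_eq, ← (norm_pow_mul_cos_add_sin _ _).1, Complex.normSq_eq_norm_sq]
  ring

theorem basisSin_eq (μ : ℝ) (l k : ℕ) (x y : ℝ) : basisSin μ l k x y =
    (if 2 * l < k then √2 else 1) * bigHConst μ l k *
      zernikeRadial (μ + 1 / 2) l (k - 2 * l) (Complex.normSq ⟨x, y⟩) *
        ((⟨x, y⟩ : ℂ) ^ (k - 2 * l)).im := by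
  rw [basisSin, radialPart_eq, ← (norm_pow_mul_cos_add_sin _ _).2, Complex.normSq_eq_norm_sq]
  ring

/-- Folding of a sum that is symmetric under `a ↦ k - a`. -/
theorem sum_range_eq_sum_half (k : ℕ) (G : ℕ → ℝ) (hG : ∀ a ≤ k, G (k - a) = G a) :
    ∑ a ∈ Finset.range (k + 1), G a =
      ∑ l ∈ Finset.range (k / 2 + 1), (if 2 * l < k then 2 else 1) * G l := by
  have h1 : ∑ l ∈ Finset.range (k / 2 + 1), (if 2 * l < k then 2 else 1) * G l =
      ∑ a ∈ Finset.range (k + 1), if 2 * a ≤ k then (if 2 * a < k then 2 else 1) * G a else 0 := by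
    rw [← Finset.sum_filter]
    refine Finset.sum_congr ?_ fun _ _ => rfl
    ext a
    simp only [Finset.mem_filter, Finset.mem_range]
    omega
  have h2 : ∑ a ∈ Finset.range (k + 1), (if k < 2 * a then G a else 0) =
      ∑ a ∈ Finset.range (k + 1), if 2 * a < k then G a else 0 := by
    rw [← Finset.sum_flip]
    refine Finset.sum_congr rfl fun a ha => ?_
    have ha' := Nat.lt_succ_iff.1 (Finset.mem_range.1 ha)
    rw [hG a ha']
    by_cases h : 2 * a < k
    · rw [if_pos (by omega), if_pos h]
    · rw [if_neg (by omega), if_neg h]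
  have h3 : ∀ a, G a = (if 2 * a ≤ k then G a else 0) + if k < 2 * a then G a else 0 := by
    intro a
    by_cases h : 2 * a ≤ k
    · rw [if_pos h, if_neg (by omega), add_zero]
    · rw [if_neg h, if_pos (by omega), zero_add]
  rw [h1, Finset.sum_congr rfl fun a _ => h3 a, Finset.sum_add_distrib, h2,
    ← Finset.sum_add_distrib]
  refine Finset.sum_congr rfl fun a _ => ?_
  rcases lt_trichotomy (2 * a) k with h | h | h
  · rw [if_pos h.le, if_pos h, if_pos h.le, if_pos h]; ring
  · rw [if_pos h.le, if_neg (by omega), if_pos h.le, if_neg (by omega)]; ring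
  · rw [if_neg (by omega), if_neg (by omega), if_neg (by omega)]; ring

/-- The kernel `D_k(ξ; x, y)` in terms of the disk polynomials. The cosine and sine elements with
index `l` combine the conjugate terms `a = l` and `a = k - l`, which accounts for the factor
`(√2)²` when `2l < k`. -/
theorem dSum_eq (hμ : 0 ≤ μ) (k : ℕ) (ξ x y : ℝ) :
    (dSum μ k ξ x y : ℂ) = ∑ a ∈ Finset.range (k + 1),
      Complex.exp (ξ * Complex.I) ^ (k - a) * Complex.exp (-(ξ * Complex.I)) ^ a *
        evalC (toC (x, y)) (zernike (μ + 1 / 2) a (k - a)) := by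
  set w := Complex.exp (ξ * Complex.I) with hw
  set u := Complex.exp (-(ξ * Complex.I)) with hu
  have huw : w * u = 1 := by rw [hw, hu, ← Complex.exp_add]; simp
  have hcw : starRingEnd ℂ w = u := by
    rw [hw, hu, ← Complex.exp_conj]; simp
  set F : ℕ → ℂ := fun a => w ^ (k - a) * u ^ a *
    evalC (toC (x, y)) (zernike (μ + 1 / 2) a (k - a)) with hF
  have hconj : ∀ a ≤ k, F (k - a) = starRingEnd ℂ (F a) := by
    intro a ha
    simp only [hF, map_mul, map_pow, ← evalC_zernike_conj, hcw, Nat.sub_sub_self ha]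
    rw [← hcw, Complex.conj_conj, mul_comm (w ^ a)]
  have him : ∑ a ∈ Finset.range (k + 1), (F a).im = 0 := by
    have h := Finset.sum_flip (n := k) fun a => (F a).im
    rw [Finset.sum_congr rfl fun a ha => by
      rw [hconj a (Nat.lt_succ_iff.1 (Finset.mem_range.1 ha)), Complex.conj_im],
      Finset.sum_neg_distrib] at h
    linarith
  have hre : ∑ a ∈ Finset.range (k + 1), (F a).re = dSum μ k ξ x y := by
    rw [sum_range_eq_sum_half k (fun a => (F a).re) fun a ha => by
      simp only [hconj a ha, Complex.conj_re], dSum]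
    refine Finset.sum_congr rfl fun l hl => ?_
    have hl' : 2 * l ≤ k := by have := Finset.mem_range.1 hl; omega
    have hxi : (⟨Real.cos ξ, Real.sin ξ⟩ : ℂ) = w := by
      apply Complex.ext
      · rw [hw, Complex.exp_ofReal_mul_I_re]
      · rw [hw, Complex.exp_ofReal_mul_I_im]
    have hns : Complex.normSq w = 1 := by
      rw [Complex.normSq_eq_norm_sq, hw, Complex.norm_exp_ofReal_mul_I]; simp
    have hFl : F l = w ^ (k - 2 * l) * starRingEnd ℂ (toC (x, y)) ^ (k - 2 * l) *
        (zernikeRadial (μ + 1 / 2) l (k - 2 * l) (Complex.normSq (toC (x, y))) : ℂ) := by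
      have h := evalC_zernike (lam := μ + 1 / 2) (by positivity) l (k - 2 * l) (toC (x, y))
      rw [show l + (k - 2 * l) = k - l by omega] at h
      simp only [hF, h]
      rw [show k - l = (k - 2 * l) + l by omega, pow_add, mul_assoc (w ^ (k - 2 * l)), ← mul_pow,
        huw, one_pow]
      ring
    have hsq : (if 2 * l < k then √2 else 1) * (if 2 * l < k then √2 else 1) =
        (if 2 * l < k then (2 : ℝ) else 1) := by
      split_ifs
      · exact Real.mul_self_sqrt (by norm_num)
      · norm_num
    have hH := (bigHConst_pos hμ l k).ne'
    rw [basisCos_eq, basisSin_eq, basisCos_eq, basisSin_eq, hxi, hns, zernikeRadial_one, hFl,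
      Complex.re_mul_ofReal, ← map_pow, Complex.mul_re, Complex.conj_re, Complex.conj_im, ← hsq,
      toC]
    field_simp
    ring
  apply Complex.ext
  · rw [Complex.re_sum, hre, Complex.ofReal_re]
  · rw [Complex.im_sum, him, Complex.ofReal_im]

end Jacobi

/-! ### Discrete orthogonality and the reconstruction formula -/

theorem sum_exp_xi {n k a b : ℕ} (hk : k ≤ n) (ha : a ≤ k) (hb : b ≤ k) (c : ℕ) :
    ∑ ν ∈ Finset.range (c * (n + 1)),
      (Complex.exp (xi n ν * Complex.I) ^ a * Complex.exp (-(xi n ν * Complex.I)) ^ (k - a)) *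
        (Complex.exp (xi n ν * Complex.I) ^ (k - b) * Complex.exp (-(xi n ν * Complex.I)) ^ b) =
      if a = b then (c * (n + 1) : ℂ) else 0 := by
  have hn : (n : ℂ) + 1 ≠ 0 := by exact_mod_cast n.succ_ne_zero
  set ω := Complex.exp (2 * Real.pi * Complex.I * ((a - b : ℤ) : ℂ) / (n + 1)) with hω
  have e : ∀ ν : ℕ, (Complex.exp (xi n ν * Complex.I) ^ a *
      Complex.exp (-(xi n ν * Complex.I)) ^ (k - a)) *
      (Complex.exp (xi n ν * Complex.I) ^ (k - b) * Complex.exp (-(xi n ν * Complex.I)) ^ b) =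
      ω ^ ν := by
    intro ν
    rw [hω]
    simp only [← Complex.exp_nat_mul, ← Complex.exp_add]
    congr 1
    rw [xi]
    push_cast [Nat.cast_sub ha, Nat.cast_sub hb]
    field_simp
    ring
  rw [Finset.sum_congr rfl fun ν _ => e ν]
  split_ifs with h
  · have : ω = 1 := by rw [hω, h]; simp
    simp [this]
  · have h1 : ω ≠ 1 := by
      intro h1
      rw [hω, Complex.exp_eq_one_iff] at h1
      obtain ⟨j, hj⟩ := h1
      have hpi : (2 * Real.pi * Complex.I : ℂ) ≠ 0 := Complex.two_pi_I_ne_zero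
      rw [div_eq_iff hn] at hj
      have h2 : ((a - b : ℤ) : ℂ) = ((j * (n + 1) : ℤ) : ℂ) := by
        apply mul_left_cancel₀ hpi
        rw [hj]; push_cast; ring
      have h3 : (a - b : ℤ) = j * (n + 1) := by exact_mod_cast h2
      have h4 : |(a - b : ℤ)| < n + 1 := by rw [abs_lt]; constructor <;> omega
      rw [h3, abs_mul, abs_of_nonneg (by positivity : (0 : ℤ) ≤ n + 1)] at h4
      have h5 : |j| < 1 := by
        by_contra h5
        nlinarith [not_lt.1 h5, (by positivity : (0 : ℤ) ≤ n)]
      rw [Int.abs_lt_one_iff.1 h5] at h3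
      omega
    have h2 : ω ^ (c * (n + 1)) = 1 := by
      rw [hω, ← Complex.exp_nat_mul, Complex.exp_eq_one_iff]
      refine ⟨c * (a - b), ?_⟩
      push_cast
      field_simp
    rw [geom_sum_eq h1, h2, sub_self, zero_div]

/-- The reconstruction formula with nodes covering a half turn `c` times. -/
theorem polyFun_eq_sum_radon {μ : ℝ} (hμ : 0 ≤ μ) {n k : ℕ} (hk : k ≤ n) {f : ℝ × ℝ → ℝ}
    (hf : MemLp f 2 (diskMeasure μ)) {P : MvPolynomial (Fin 2) ℝ} (hdeg : P.totalDegree ≤ k)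
    (hP : diskProj μ k (hf.toLp f) =ᵐ[diskMeasure μ] polyFun P) {c : ℕ} (hc : c ≠ 0) (x y : ℝ) :
    polyFun P (x, y) = 1 / ((c : ℝ) * (n + 1)) * ∑ ν ∈ Finset.range (c * (n + 1)),
      aConst μ * ∫ t in (-1 : ℝ)..1, radon μ f (xi n ν) t * dKernel μ k (xi n ν) t x y := by
  obtain ⟨d, hd, hR⟩ := exists_zernike_expansion hμ hf hdeg hP
  have hterm : ∀ ξ, aConst μ * ∫ t in (-1 : ℝ)..1, radon μ f ξ t * dKernel μ k ξ t x y =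
      ((k + μ + 1 / 2) / (μ + 1 / 2) *
        ∫ p, f p * polyFun (realRidge μ k ξ) p ∂(diskMeasure μ)) * dSum μ k ξ x y := by
    intro ξ
    have e : ∀ t, radon μ f ξ t * dKernel μ k ξ t x y =
        (k + μ + 1 / 2) / (μ + 1 / 2) * dSum μ k ξ x y *
          (radon μ f ξ t * (gegenbauer (μ + 1 / 2) k).eval t) := by
      intro t; rw [dKernel]; ring
    simp only [polyFun_realRidge, e]
    rw [← integral_radon_mul hμ hf (g := fun t => (gegenbauer (μ + 1 / 2) k).eval t)
      (Polynomial.continuous _) ξ, intervalIntegral.integral_const_mul]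
    ring
  have hcn : (c : ℂ) * (n + 1) ≠ 0 :=
    mul_ne_zero (by exact_mod_cast hc) (by exact_mod_cast n.succ_ne_zero)
  apply Complex.ofReal_injective
  simp only [hterm]
  rw [hd, Complex.ofReal_mul, Complex.ofReal_sum]
  simp only [Complex.ofReal_mul _ (dSum μ k _ x y), hR, dSum_eq hμ, Finset.sum_mul_sum]
  have hcast : ((1 / ((c : ℝ) * (n + 1)) : ℝ) : ℂ) = ((c : ℂ) * (n + 1))⁻¹ := by
    push_cast; rw [one_div]
  rw [Finset.sum_comm, hcast, eq_inv_mul_iff_mul_eq₀ hcn, Finset.mul_sum]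
  refine Finset.sum_congr rfl fun a ha => ?_
  rw [Finset.sum_comm]
  have ha' := Nat.lt_succ_iff.1 (Finset.mem_range.1 ha)
  have e : ∀ b ∈ Finset.range (k + 1), ∑ ν ∈ Finset.range (c * (n + 1)),
      d a * (Complex.exp (xi n ν * Complex.I) ^ a * Complex.exp (-(xi n ν * Complex.I)) ^ (k - a)) *
        (Complex.exp (xi n ν * Complex.I) ^ (k - b) * Complex.exp (-(xi n ν * Complex.I)) ^ b *
          evalC (toC (x, y)) (zernike (μ + 1 / 2) b (k - b))) =
      d a * evalC (toC (x, y)) (zernike (μ + 1 / 2) b (k - b)) *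
        if a = b then (c * (n + 1) : ℂ) else 0 := by
    intro b hb
    rw [← sum_exp_xi hk ha' (Nat.lt_succ_iff.1 (Finset.mem_range.1 hb)) c, Finset.mul_sum]
    exact Finset.sum_congr rfl fun ν _ => by ring
  rw [Finset.sum_congr rfl e, Finset.sum_eq_single a (fun b _ hb => by rw [if_neg hb.symm, mul_zero])
    (fun h => (h ha).elim), if_pos rfl]
  ring

end AttRadon

theorem theorem2p8 (μ : ℝ) (hμ : 0 ≤ μ) (n k : ℕ) (hk : k ≤ n) (f : ℝ × ℝ → ℝ)
    (hf : MemLp f 2 (AttRadon.diskMeasure μ)) :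
    -- the Radon projections and the integrals against the kernel converge
    (∀ θ : ℝ,
      (∀ᵐ t ∂(volume.restrict (Set.Icc (-1 : ℝ) 1)),
        IntervalIntegrable (AttRadon.lineIntegrand μ f θ t) volume
          (-√(1 - t ^ 2)) (√(1 - t ^ 2))) ∧
      ∀ x y : ℝ, IntervalIntegrable
        (fun t => AttRadon.radon μ f θ t * AttRadon.dKernel μ k θ t x y) volume (-1) 1) ∧
    -- the projection of `f` is given by a polynomial `P`, and both formulas hold for `P`
    ∃ P : MvPolynomial (Fin 2) ℝ, P.totalDegree ≤ k ∧
      AttRadon.diskProj μ k (hf.toLp f) =ᵐ[AttRadon.diskMeasure μ] AttRadon.polyFun P ∧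
      ∀ x y : ℝ,
        AttRadon.polyFun P (x, y) = 1 / ((n : ℝ) + 1) * ∑ ν ∈ Finset.range (n + 1),
          AttRadon.aConst μ * ∫ t in (-1 : ℝ)..1,
            AttRadon.radon μ f (AttRadon.xi n ν) t *
              AttRadon.dKernel μ k (AttRadon.xi n ν) t x y ∧
        AttRadon.polyFun P (x, y) = 1 / (2 * (n : ℝ) + 2) * ∑ ν ∈ Finset.range (2 * n + 2),
          AttRadon.aConst μ * ∫ t in (-1 : ℝ)..1,
            AttRadon.radon μ f (AttRadon.xi n ν) t *
              AttRadon.dKernel μ k (AttRadon.xi n ν) t x y := by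
  have hint : Integrable f (AttRadon.diskMeasure μ) := by
    simpa using AttRadon.integrable_mul_of_continuous hμ hf (g := fun _ => 1) continuous_const
  refine ⟨fun θ => ⟨AttRadon.ae_intervalIntegrable_lineIntegrand hμ hint θ, fun x y => ?_⟩, ?_⟩
  · refine AttRadon.intervalIntegrable_radon_mul hμ hf ?_ θ
    unfold AttRadon.dKernel
    exact (continuous_const.mul (Polynomial.continuous _)).mul continuous_const
  · obtain ⟨P, hdeg, hP⟩ := AttRadon.exists_polyFun_diskProj μ k (hf.toLp f)
    refine ⟨P, hdeg, hP, fun x y => ⟨?_, ?_⟩⟩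
    · simpa using AttRadon.polyFun_eq_sum_radon hμ hk hf hdeg hP one_ne_zero x y
    · have h := AttRadon.polyFun_eq_sum_radon hμ hk hf hdeg hP two_ne_zero x y
      rwa [show 2 * (n + 1) = 2 * n + 2 by ring,
        show ((2 : ℕ) : ℝ) * (n + 1) = 2 * (n : ℝ) + 2 by push_cast; ring] at h
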